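/- Let $X=[c_0,c_N]\subset\mathbb R$ with $c_0<c_1<\dots<c_N$ and $N\ge 2$, let $E\subset\{c_0,c_N\}$ (possibly empty), put $\Delta=\{c_1,\dots,c_{N-1}\}\cup E$, and let $X_i=[c_{i-1},c_i]\setminus\Delta$ for $1\le i\le N$ be the contraction pieces. Let $f:X\to X$ be a piecewise contracting interval map: there is $\lambda\in(0,1)$ such that $|f(x)-f(y)|\le\lambda|x-y|$ for all $x,y\in X_i$ and all $i$. Write $d_k^-=\lim_{y\to c_k^-}f(y)$ and $d_k^+=\lim_{y\to c_k^+}f(y)$ for $1\le k\le N-1$, $d_0=\lim_{y\to c_0^+}f(y)$, $d_N=\lim_{y\to c_N^-}f(y)$, and let $D=\{d_0,d_N\}\cup\{d_k^\pm:1\le k\le N-1\}$. Let $\widetilde X$ be the set of $x\in X$ such that $f^n(x)\notin\Delta$ for all $n\ge 0$. Let $\mathcal O(x)=\{f^n(x):n\ge 0\}$, let $\omega(x)$ be the set of limits of subsequences of $(f^n(x))_{n\ge 0}$, and let the attractor be $\Lambda=\bigcap_{n\ge 1}\Lambda_n$, where $\Lambda_1=\overline{f(X\setminus\Delta)}$ and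 $\Lambda_{n+1}=\overline{f(\Lambda_n\setminus\Delta)}$. A set $A\subset X$ is pseudo-invariant if for every $x\in A$ one of the one-sided limits (from within $X$) $\lim_{y\to x^-}f(y)$, $\lim_{y\to x^+}f(y)$ belongs to $A$; it is $\widetilde X$-minimal if $\overline{\mathcal O(x)}=A$ for every $x\in A\cap\widetilde X$. A Cantor set is a nonempty compact perfect totally disconnected set. A gap of $K\subset X$ is a connected component of $X\setminus K$. Suppose that $f$ is injective on each contraction piece and that $D\subset\widetilde X$. Then there exist natural numbers $N_1,N_2\ge 0$, periodic orbits $\mathcal O_1,\dots,\mathcal O_{N_1}\subset\widetilde X$ and $\widetilde X$-minimal pseudo-invariant Cantor sets $K_1,\dots,K_{N_2}\subset X$, all these sets being pairwise distinct, such that: 1. $\Lambda=\bigcup_{i=1}^{N_1}\mathcal O_i\cup\bigcup_{j=1}^{N_2}K_j$. 2. For every $x\in\widetilde X$, either $\omega(x)=\mathcal O_i$ for some $i$ or $\omega(x)=K_j$ for some $j$. 3. For every $j$ there is $k\in\{1,\dots,N-1\}$ such that $c_k\in K_j$ and $K_j=\overline{\mathcal O(d_k^+)}=\overline{\mathcal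 O(d_k^-)}$. 4. For every $j$ and every $k\in\{1,\dots,N-1\}$ with $c_k\in K_j$ we have $K_j=\overline{\mathcal O(d_k^+)}$ or $K_j=\overline{\mathcal O(d_k^-)}$; if moreover $c_k$ is not on the boundary of a gap of $K_j$, then $\overline{\mathcal O(d_k^+)}=\overline{\mathcal O(d_k^-)}$. 5. $1\le N_1+N_2\le \# D$ and $N_1+2N_2\le 2(N-1)$; and if $f$ is increasing on each contraction piece, then $N_1+N_2\le N$. -/

import Mathlib

open Set Filter Topology

/-- A piecewise contracting interval map. The phase space is `X = [c 0, c N]` with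
`c 0 < c 1 < ... < c N`, `N ≥ 2` (only the values `c 0, ..., c N` matter). The pieces are cut out by
`Δ = {c 1, ..., c (N-1)} ∪ ends`, where `ends ⊆ {c 0, c N}`: if `ends = ∅` the first and the last
piece are half-closed and contain the corresponding end point of `X`; an end point that is put in
`ends` is removed from its piece. Nothing is required of the values of the map on `Δ`, except that
they lie in `X`; the values of `toFun` outside `X` play no role. -/
structure PCIM where
  N : ℕ
  two_le_N : 2 ≤ N
  c : ℕ → ℝ
  c_lt : ∀ k < N, c k < c (k + 1)
  ends : Set ℝ
  ends_subset : ends ⊆ {c 0, c N}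
  toFun : ℝ → ℝ
  mapsTo : MapsTo toFun (Icc (c 0) (c N)) (Icc (c 0) (c N))
  contracting : ∃ lam : ℝ, 0 < lam ∧ lam < 1 ∧ ∀ i < N,
    ∀ x ∈ Icc (c i) (c (i + 1)) \ ({y | ∃ k, 1 ≤ k ∧ k < N ∧ y = c k} ∪ ends),
    ∀ y ∈ Icc (c i) (c (i + 1)) \ ({y | ∃ k, 1 ≤ k ∧ k < N ∧ y = c k} ∪ ends),
      |toFun x - toFun y| ≤ lam * |x - y|

/-- The forward orbit of `x`. -/
def orbit (f : ℝ → ℝ) (x : ℝ) : Set ℝ := range fun n : ℕ => f^[n] x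

/-- The `ω`-limit set of the point `x` under the iterates of `f`. -/
def omegaSet (f : ℝ → ℝ) (x : ℝ) : Set ℝ :=
  omegaLimit atTop (fun (n : ℕ) (y : ℝ) => f^[n] y) {x}

theorem mem_omegaSet_iff {f : ℝ → ℝ} {x y : ℝ} : y ∈ omegaSet f x ↔
    ∃ φ : ℕ → ℕ, StrictMono φ ∧ Tendsto (fun j => f^[φ j] x) atTop (𝓝 y) := by
  rw [omegaSet, mem_omegaLimit_singleton_iff_mapClusterPt]
  constructor
  · exact fun h => h.tendsto_subseq
  · rintro ⟨φ, hφ, h⟩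
    exact MapClusterPt.of_comp hφ.tendsto_atTop h.mapClusterPt

/-- A Cantor subset of the line: nonempty, compact, perfect and totally disconnected. -/
structure IsCantorSet (K : Set ℝ) : Prop where
  nonempty : K.Nonempty
  isCompact : IsCompact K
  perfect : Perfect K
  isTotallyDisconnected : IsTotallyDisconnected K

/-- `c` lies on the boundary of a gap of `K` in `X`: a gap is a connected component of `X \ K`. -/
def IsGapBoundaryPoint (X K : Set ℝ) (c : ℝ) : Prop :=
  ∃ y ∈ X \ K, c ∈ frontier (connectedComponentIn (X \ K) y)

namespace PCIM

variable (F : PCIM)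

/-- The phase space. -/
def X : Set ℝ := Icc (F.c 0) (F.c F.N)

/-- The set of boundaries of the contraction pieces. -/
def Δ : Set ℝ := {y | ∃ k, 1 ≤ k ∧ k < F.N ∧ y = F.c k} ∪ F.ends

/-- The contraction pieces, numbered from `0` to `N - 1`: `piece i` lies between `c i` and
`c (i + 1)`. -/
def piece (i : ℕ) : Set ℝ := Icc (F.c i) (F.c (i + 1)) \ F.Δ

/-- The left limit `d_k⁻` of the map at `c k`, `1 ≤ k ≤ N` (with `d_N = d_N⁻`). -/
noncomputable def dMinus (k : ℕ) : ℝ := Function.leftLim F.toFun (F.c k)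

/-- The right limit `d_k⁺` of the map at `c k`, `0 ≤ k ≤ N - 1` (with `d_0 = d_0⁺`). -/
noncomputable def dPlus (k : ℕ) : ℝ := Function.rightLim F.toFun (F.c k)

/-- The set `D` of all one-sided limits of the map at the extreme points of the pieces. -/
def D : Set ℝ :=
  {y | ∃ k, 1 ≤ k ∧ k ≤ F.N ∧ y = F.dMinus k} ∪ {y | ∃ k, k < F.N ∧ y = F.dPlus k}

/-- The points of `X` whose forward orbit never meets `Δ`. -/
def Xtilde : Set ℝ := {x | ∀ n : ℕ, F.toFun^[n] x ∈ F.X \ F.Δ}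

/-- The decreasing sets whose intersection is the attractor (`lambdaSeq n` is `Λ_{n+1}`). -/
def lambdaSeq : ℕ → Set ℝ
  | 0 => closure (F.toFun '' (F.X \ F.Δ))
  | n + 1 => closure (F.toFun '' (lambdaSeq n \ F.Δ))

/-- The attractor `Λ`. -/
def attractor : Set ℝ := ⋂ n : ℕ, F.lambdaSeq n

/-- `A ⊆ X` is pseudo-invariant: for each `x ∈ A`, the left limit or the right limit of the map
at `x` exists and belongs to `A` (at an end point of `X` only the limit from inside `X` counts). -/
def IsPseudoInvariant (A : Set ℝ) : Prop :=
  A ⊆ F.X ∧ ∀ x ∈ A, ∃ y ∈ A,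
    (F.c 0 < x ∧ Tendsto F.toFun (𝓝[<] x) (𝓝 y)) ∨
    (x < F.c F.N ∧ Tendsto F.toFun (𝓝[>] x) (𝓝 y))

/-- `A ⊆ X` is `X̃`-minimal: the orbit of each point of `A ∩ X̃` has closure `A`. -/
def IsXtildeMinimal (A : Set ℝ) : Prop :=
  A ⊆ F.X ∧ ∀ x ∈ A ∩ F.Xtilde, closure (orbit F.toFun x) = A

/-- A periodic orbit contained in `X̃`. -/
def IsPeriodicOrbit (A : Set ℝ) : Prop :=
  A ⊆ F.Xtilde ∧ ∃ x ∈ Function.periodicPts F.toFun, A = orbit F.toFun x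

theorem c_lt_c {j k : ℕ} (hjk : j < k) (hk : k ≤ F.N) : F.c j < F.c k := by
  induction k, hjk using Nat.le_induction with
  | base => exact F.c_lt j hk
  | succ k _ ih => exact (ih (by omega)).trans (F.c_lt k hk)

theorem Ioo_subset_piece {i : ℕ} (hi : i < F.N) : Ioo (F.c i) (F.c (i + 1)) ⊆ F.piece i := by
  intro x hx
  have hle : ∀ {j k : ℕ}, j ≤ k → k ≤ F.N → F.c j ≤ F.c k := fun {j k} h hk => by
    rcases h.lt_or_eq with h | rfl
    · exact (F.c_lt_c h hk).le
    · exact le_rfl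
  have key : ∀ k ≤ F.N, x ≠ F.c k := by
    rintro k hk rfl
    rcases le_or_gt k i with h | h
    · exact (hle h hi.le).not_gt hx.1
    · exact (hle (show i + 1 ≤ k from h) hk).not_gt hx.2
  refine ⟨⟨hx.1.le, hx.2.le⟩, ?_⟩
  rintro (⟨k, -, hk, rfl⟩ | h)
  · exact key k hk.le rfl
  · rcases F.ends_subset h with h | h
    · exact key 0 (Nat.zero_le _) h
    · exact key F.N le_rfl h

/-- The restriction of the map to a piece has a limit at every point, so the one-sided limits
are genuine. -/
theorem exists_tendsto_piece {i : ℕ} (hi : i < F.N) (x : ℝ) :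
    ∃ y, Tendsto F.toFun (𝓝[F.piece i] x) (𝓝 y) := by
  obtain ⟨lam, h0, -, h⟩ := F.contracting
  have hL : LipschitzOnWith ⟨lam, h0.le⟩ F.toFun (F.piece i) :=
    LipschitzOnWith.of_dist_le_mul fun x hx y hy => by
      rw [Real.dist_eq, Real.dist_eq]
      exact h i hi x hx y hy
  obtain ⟨g, hg, hfg⟩ := hL.extend_real
  refine ⟨g x, ?_⟩
  have h1 : Tendsto g (𝓝[F.piece i] x) (𝓝 (g x)) := hg.continuous.continuousAt.mono_left inf_le_left
  exact h1.congr' (eventually_nhdsWithin_of_forall fun y hy => (hfg hy).symm)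

theorem tendsto_dMinus {k : ℕ} (hk : 1 ≤ k) (hkN : k ≤ F.N) :
    Tendsto F.toFun (𝓝[<] F.c k) (𝓝 (F.dMinus k)) := by
  obtain ⟨i, rfl⟩ : ∃ i, k = i + 1 := ⟨k - 1, by omega⟩
  obtain ⟨y, hy⟩ := F.exists_tendsto_piece (i := i) hkN (F.c (i + 1))
  have h2 : Tendsto F.toFun (𝓝[<] F.c (i + 1)) (𝓝 y) := by
    rw [← nhdsWithin_Ioo_eq_nhdsLT (F.c_lt i hkN)]
    exact hy.mono_left (nhdsWithin_mono _ (F.Ioo_subset_piece hkN))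
  exact tendsto_leftLim_of_tendsto ⟨y, h2⟩

theorem tendsto_dPlus {k : ℕ} (hkN : k < F.N) :
    Tendsto F.toFun (𝓝[>] F.c k) (𝓝 (F.dPlus k)) := by
  obtain ⟨y, hy⟩ := F.exists_tendsto_piece hkN (F.c k)
  have h2 : Tendsto F.toFun (𝓝[>] F.c k) (𝓝 y) := by
    rw [← nhdsWithin_Ioo_eq_nhdsGT (F.c_lt k hkN)]
    exact hy.mono_left (nhdsWithin_mono _ (F.Ioo_subset_piece hkN))
  exact tendsto_rightLim_of_tendsto ⟨y, h2⟩

end PCIM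

/-! Two points of `X \ Δ` with no point of `Δ` between them lie in one piece, so `f` contracts their
distance by `lam`. Orbits that are never separated by `Δ` are therefore asymptotic
(`omegaSet_eq_of_notSep`). Hence, if `ω(x)` avoids `Δ`, a close return makes the orbit shadow its
own shift, and `ω(x)` is a periodic orbit (`isPeriodicOrbit_omegaSet`).

If `ω(x)` meets `Δ`, the orbit approaches some `c ∈ Δ` from one side, and the one-sided limit there
belongs to `ω(x)`. Relate side `s` to side `t` when the orbit of the limit at `s` accumulates at
`t`. This relation is transitive, and on the finite set of sides visited by `x` it has no dead end,
so some side is related to itself: its limit `d` returns to it. For such a recurrent side, every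
orbit visiting it has limit set `ω(d)` (`omegaSet_eq_omegaSet_sideLim`): the orbit is trapped in
intervals with end points in `ω(d)`. Injectivity makes `f` monotone on pieces, so the image of such
an interval lies between the one-sided limits at its ends; if `Δ` cuts the image, one keeps the part
containing the orbit. The lengths decay geometrically.

This rigidity gives minimality of `ω(d)`. Moreover `ω(d)` is infinite because it contains a point of
`Δ`, perfect because the orbit of `d` does not repeat, and totally disconnected because contraction
on the pieces forces measure zero. Some point of `Δ` is approached from both sides
(`IsRecurrentSide.exists_visits_both`), since otherwise the orbit of `d` would again shadow its own
shift.

The attractor is covered at every scale by finitely many short nondegenerate intervals with end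
points on the orbits of `D`, so it is the union of the sets `ω(d)`, `d ∈ D`. For the counting, a
periodic orbit attracts the one-sided limit at the interior `c k` nearest to it, while a Cantor set
uses up both limits at some `c k`. -/

namespace PCIM

variable (F : PCIM)

/-! ### The partition -/

theorem c_le_c {j k : ℕ} (hjk : j ≤ k) (hk : k ≤ F.N) : F.c j ≤ F.c k := by
  rcases hjk.lt_or_eq with h | rfl
  · exact (F.c_lt_c h hk).le
  · exact le_rfl

theorem c_zero_lt_c_N : F.c 0 < F.c F.N :=
  F.c_lt_c (by have := F.two_le_N; omega) le_rfl

theorem c_mem_X {k : ℕ} (hk : k ≤ F.N) : F.c k ∈ F.X :=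
  ⟨F.c_le_c (Nat.zero_le _) hk, F.c_le_c hk le_rfl⟩

theorem c_mem_Δ {k : ℕ} (h1 : 1 ≤ k) (hk : k < F.N) : F.c k ∈ F.Δ :=
  Or.inl ⟨k, h1, hk, rfl⟩

theorem exists_eq_c_of_mem_Δ {x : ℝ} (hx : x ∈ F.Δ) : ∃ k ≤ F.N, x = F.c k := by
  rcases hx with ⟨k, -, hk, rfl⟩ | h
  · exact ⟨k, hk.le, rfl⟩
  · rcases F.ends_subset h with h | h
    · exact ⟨0, Nat.zero_le _, h⟩
    · exact ⟨F.N, le_rfl, h⟩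

theorem Δ_subset_X : F.Δ ⊆ F.X := fun x hx => by
  obtain ⟨k, hk, rfl⟩ := F.exists_eq_c_of_mem_Δ hx
  exact F.c_mem_X hk

theorem finite_Δ : F.Δ.Finite := by
  refine ((Set.finite_Iic F.N).image F.c).subset fun x hx => ?_
  obtain ⟨k, hk, rfl⟩ := F.exists_eq_c_of_mem_Δ hx
  exact ⟨k, hk, rfl⟩

theorem isCompact_X : IsCompact F.X := isCompact_Icc

theorem isClosed_X : IsClosed F.X := isClosed_Icc

theorem exists_mem_Icc_c {x : ℝ} (hx : x ∈ F.X) : ∃ i < F.N, x ∈ Icc (F.c i) (F.c (i + 1)) := by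
  classical
  by_cases h : ∃ k, k < F.N ∧ x ≤ F.c (k + 1)
  · have hs := Nat.find_spec h
    refine ⟨Nat.find h, hs.1, ?_, hs.2⟩
    rcases Nat.eq_zero_or_pos (Nat.find h) with h0 | h0
    · rw [h0]; exact hx.1
    · by_contra hlt
      refine Nat.find_min h (m := Nat.find h - 1) (by omega) ⟨by omega, ?_⟩
      rw [Nat.sub_add_cancel h0]
      exact (not_le.1 hlt).le
  · exfalso
    apply h
    refine ⟨F.N - 1, by have := F.two_le_N; omega, ?_⟩
    rw [Nat.sub_add_cancel (by have := F.two_le_N; omega)]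
    exact hx.2

theorem exists_c_le_and_le_c {a b : ℝ} (ha : a ∈ F.X) (hb : b ∈ F.X) (hab : a < b)
    (h : ∀ c ∈ F.Δ, c ∉ Ioo a b) : ∃ i < F.N, F.c i ≤ a ∧ b ≤ F.c (i + 1) := by
  obtain ⟨u, hu⟩ := exists_between hab
  obtain ⟨i, hi, hui⟩ := F.exists_mem_Icc_c (x := u) ⟨ha.1.trans hu.1.le, hu.2.le.trans hb.2⟩
  refine ⟨i, hi, ?_, ?_⟩
  · rcases Nat.eq_zero_or_pos i with rfl | h0
    · exact ha.1
    · by_contra hlt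
      exact h _ (F.c_mem_Δ h0 hi) ⟨not_le.1 hlt, hui.1.trans_lt hu.2⟩
  · rcases (Nat.succ_le_of_lt hi).lt_or_eq with h0 | h0
    · by_contra hlt
      exact h _ (F.c_mem_Δ (Nat.le_add_left 1 i) h0) ⟨hu.1.trans_le hui.2, not_le.1 hlt⟩
    · rw [show i + 1 = F.N from h0]
      exact hb.2

/-- The contraction rate. -/
noncomputable def lam : ℝ := F.contracting.choose

theorem lam_pos : 0 < F.lam := F.contracting.choose_spec.1

theorem lam_lt_one : F.lam < 1 := F.contracting.choose_spec.2.1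

theorem abs_sub_le_of_mem_piece {i : ℕ} (hi : i < F.N) {x y : ℝ} (hx : x ∈ F.piece i)
    (hy : y ∈ F.piece i) : |F.toFun x - F.toFun y| ≤ F.lam * |x - y| :=
  F.contracting.choose_spec.2.2 i hi x hx y hy

theorem exists_mem_piece {x : ℝ} (hx : x ∈ F.X \ F.Δ) : ∃ i < F.N, x ∈ F.piece i := by
  obtain ⟨i, hi, h⟩ := F.exists_mem_Icc_c hx.1
  exact ⟨i, hi, h, hx.2⟩

theorem piece_subset {i : ℕ} (hi : i < F.N) : F.piece i ⊆ F.X \ F.Δ := fun _ hx =>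
  ⟨⟨(F.c_le_c (Nat.zero_le _) hi.le).trans hx.1.1, hx.1.2.trans (F.c_le_c hi le_rfl)⟩, hx.2⟩

/-- No point of `Δ` lies between `u` and `v`. -/
def NotSep (u v : ℝ) : Prop := ∀ c ∈ F.Δ, u < c ↔ v < c

variable {F} in
theorem NotSep.symm {u v : ℝ} (h : F.NotSep u v) : F.NotSep v u := fun c hc => (h c hc).symm

theorem _root_.lt_iff_lt_of_abs_lt {u v c : ℝ} (this : |u - v| < |u - c|) : u < c ↔ v < c := by
  constructor
  · intro h1
    by_contra h2
    rw [abs_of_neg (by linarith : u - c < 0)] at this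
    have := neg_le_abs (u - v)
    linarith
  · intro h1
    by_contra h2
    rw [abs_of_nonneg (by linarith : 0 ≤ u - c)] at this
    have := le_abs_self (u - v)
    linarith

/-- Only the points of `Δ` in the interior of `X` can separate. -/
theorem notSep_of_interior {u v : ℝ} (hu : u ∈ F.X \ F.Δ) (hv : v ∈ F.X \ F.Δ)
    (h : ∀ k, 1 ≤ k → k < F.N → (u < F.c k ↔ v < F.c k)) : F.NotSep u v := by
  intro c hc
  obtain ⟨k, hk, rfl⟩ := F.exists_eq_c_of_mem_Δ hc
  rcases Nat.eq_zero_or_pos k with rfl | h0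
  · exact iff_of_false (not_lt.2 hu.1.1) (not_lt.2 hv.1.1)
  rcases hk.lt_or_eq with h1 | rfl
  · exact h k h0 h1
  · exact iff_of_true (lt_of_le_of_ne hu.1.2 fun e => hu.2 (e ▸ hc))
      (lt_of_le_of_ne hv.1.2 fun e => hv.2 (e ▸ hc))

theorem exists_piece_of_notSep {u v : ℝ} (hu : u ∈ F.X \ F.Δ) (hv : v ∈ F.X \ F.Δ)
    (h : F.NotSep u v) : ∃ i < F.N, u ∈ F.piece i ∧ v ∈ F.piece i := by
  wlog huv : u ≤ v generalizing u v
  · obtain ⟨i, hi, h1, h2⟩ := this hv hu h.symm (not_le.1 huv).le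
    exact ⟨i, hi, h2, h1⟩
  obtain ⟨i, hi, hui⟩ := F.exists_mem_piece hu
  refine ⟨i, hi, hui, ⟨hui.1.1.trans huv, ?_⟩, hv.2⟩
  rcases (Nat.succ_le_of_lt hi).lt_or_eq with h1 | h1
  · have hc : F.c (i + 1) ∈ F.Δ := F.c_mem_Δ (by omega) h1
    have : u < F.c (i + 1) := lt_of_le_of_ne hui.1.2 fun e => hu.2 (e ▸ hc)
    exact ((h _ hc).1 this).le
  · rw [show i + 1 = F.N from h1]
    exact hv.1.2

theorem abs_sub_le_of_notSep {u v : ℝ} (hu : u ∈ F.X \ F.Δ) (hv : v ∈ F.X \ F.Δ)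
    (h : F.NotSep u v) : |F.toFun u - F.toFun v| ≤ F.lam * |u - v| := by
  obtain ⟨i, hi, h1, h2⟩ := F.exists_piece_of_notSep hu hv h
  exact F.abs_sub_le_of_mem_piece hi h1 h2

theorem exists_pos_Δ_far {u : ℝ} (hu : u ∉ F.Δ) : ∃ δ > 0, ∀ c ∈ F.Δ, δ ≤ |u - c| := by
  have h : F.Δᶜ ∈ 𝓝 u := F.finite_Δ.isClosed.isOpen_compl.mem_nhds hu
  obtain ⟨δ, hδ, h⟩ := Metric.mem_nhds_iff.1 h
  refine ⟨δ, hδ, fun c hc => ?_⟩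
  by_contra hlt
  have hc' : c ∈ Metric.ball u δ := by
    rw [Metric.mem_ball, Real.dist_eq, abs_sub_comm]
    exact not_le.1 hlt
  exact h hc' hc

theorem _root_.Set.Finite.exists_pos_separated {S : Set ℝ} (h : S.Finite) :
    ∃ ε > 0, ∀ c ∈ S, ∀ c' ∈ S, |c - c'| < ε → c = c' := by
  have h2 : {p : ℝ × ℝ | p ∈ S ×ˢ S ∧ p.1 ≠ p.2}.Finite := (h.prod h).subset fun p hp => hp.1
  obtain ⟨ε, hε, H⟩ : ∃ ε > 0, ∀ p ∈ {p : ℝ × ℝ | p ∈ S ×ˢ S ∧ p.1 ≠ p.2}, ε ≤ |p.1 - p.2| := by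
    rcases Set.eq_empty_or_nonempty {p : ℝ × ℝ | p ∈ S ×ˢ S ∧ p.1 ≠ p.2} with he | hne
    · exact ⟨1, one_pos, fun p hp => absurd hp (he ▸ notMem_empty p)⟩
    · obtain ⟨p, hp, hmin⟩ := Set.exists_min_image _ (fun p : ℝ × ℝ => |p.1 - p.2|) h2 hne
      exact ⟨_, abs_pos.2 (sub_ne_zero.2 hp.2), hmin⟩
  refine ⟨ε, hε, fun c hc c' hc' hlt => ?_⟩
  by_contra hne
  exact absurd (H (c, c') ⟨⟨hc, hc'⟩, hne⟩) (not_le.2 hlt)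

theorem continuousWithinAt_of_notMem_Δ {x : ℝ} (hx : x ∈ F.X \ F.Δ) :
    ContinuousWithinAt F.toFun F.X x := by
  obtain ⟨δ, hδ, hfar⟩ := F.exists_pos_Δ_far hx.2
  rw [Metric.continuousWithinAt_iff]
  intro ε hε
  refine ⟨min δ ε, lt_min hδ hε, fun {y} hy hd => ?_⟩
  rw [Real.dist_eq] at hd ⊢
  have hns : F.NotSep x y := fun c hc => lt_iff_lt_of_abs_lt <|
    (abs_sub_comm y x ▸ hd.trans_le (min_le_left _ _)).trans_le (hfar c hc)
  have hyΔ : y ∉ F.Δ := fun hy' => by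
    have := hfar y hy'
    rw [abs_sub_comm] at this
    exact absurd (hd.trans_le (min_le_left _ _)) (not_lt.2 this)
  calc _ ≤ F.lam * |y - x| := F.abs_sub_le_of_notSep ⟨hy, hyΔ⟩ hx hns.symm
    _ ≤ 1 * |y - x| := by gcongr; exact F.lam_lt_one.le
    _ < ε := by rw [one_mul]; exact hd.trans_le (min_le_right _ _)

/-! ### Orbits in `X̃` -/

theorem iterate_mem_X {x : ℝ} (hx : x ∈ F.X) (n : ℕ) : F.toFun^[n] x ∈ F.X :=
  F.mapsTo.iterate n hx

theorem Xtilde_subset_X : F.Xtilde ⊆ F.X := fun _ hx => (hx 0).1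

theorem iterate_mem_Xtilde {x : ℝ} (hx : x ∈ F.Xtilde) (n : ℕ) : F.toFun^[n] x ∈ F.Xtilde :=
  fun m => by rw [← Function.iterate_add_apply]; exact hx _

theorem continuousWithinAt_iterate {x : ℝ} (hx : x ∈ F.Xtilde) (n : ℕ) :
    ContinuousWithinAt F.toFun^[n] F.X x := by
  induction n with
  | zero => exact continuousWithinAt_id
  | succ n ih =>
    rw [Function.iterate_succ']
    exact (F.continuousWithinAt_of_notMem_Δ (hx n)).comp ih fun y hy => F.iterate_mem_X hy n

/-- The orbit of `x` enters infinitely often each element of the filter `G`. -/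
def Visits (x : ℝ) (G : Filter ℝ) : Prop := ∀ U ∈ G, ∃ᶠ n in atTop, F.toFun^[n] x ∈ U

theorem mem_omegaSet_iff_visits {x y : ℝ} : y ∈ omegaSet F.toFun x ↔ F.Visits x (𝓝 y) := by
  rw [omegaSet, mem_omegaLimit_singleton_iff_mapClusterPt, mapClusterPt_iff_frequently]
  rfl

variable {F} in
theorem Visits.mono {x : ℝ} {G H : Filter ℝ} (h : F.Visits x G) (hGH : G ≤ H) : F.Visits x H :=
  fun U hU => h U (hGH hU)

theorem visits_iterate_iff {x : ℝ} {G : Filter ℝ} (m : ℕ) :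
    F.Visits (F.toFun^[m] x) G ↔ F.Visits x G := by
  refine forall₂_congr fun U _ => ?_
  simp_rw [← Function.iterate_add_apply]
  conv_rhs => rw [← map_add_atTop_eq_nat m, frequently_map]

theorem omegaSet_iterate {x : ℝ} (m : ℕ) :
    omegaSet F.toFun (F.toFun^[m] x) = omegaSet F.toFun x := by
  ext y
  rw [mem_omegaSet_iff_visits, mem_omegaSet_iff_visits, visits_iterate_iff]

theorem visits_of_visits_sup {x : ℝ} {G H : Filter ℝ} (h : F.Visits x (G ⊔ H)) :
    F.Visits x G ∨ F.Visits x H := by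
  by_contra hcon
  simp only [Visits, not_or, not_forall, not_frequently] at hcon
  obtain ⟨⟨U, hU, hU'⟩, V, hV, hV'⟩ := hcon
  refine h (U ∪ V) ⟨mem_of_superset hU subset_union_left,
    mem_of_superset hV subset_union_right⟩ ?_
  filter_upwards [hU', hV'] with n h1 h2 h3
  exact h3.elim h1 h2

variable {F} in
theorem Visits.map {x : ℝ} (hx : x ∈ F.X) {G H : Filter ℝ} (h : F.Visits x G)
    (hf : Tendsto F.toFun (G ⊓ 𝓟 F.X) H) : F.Visits x H := by
  intro U hU
  have h1 : {y | y ∈ F.X → F.toFun y ∈ U} ∈ G := mem_inf_principal.1 (hf hU)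
  have h2 := h _ h1
  rw [← map_add_atTop_eq_nat 1, frequently_map]
  refine h2.mono fun n hn => ?_
  rw [Function.iterate_succ_apply']
  exact hn (F.iterate_mem_X hx n)

/-- An orbit that accumulates at a point of `X̃` accumulates wherever the orbit of that point
does. -/
theorem Visits.trans {F : PCIM} {x y : ℝ} (hx : x ∈ F.X) (hy : y ∈ F.Xtilde)
    (hxy : F.Visits x (𝓝 y)) {G : Filter ℝ} (hG : ∀ U ∈ G, ∃ V ∈ G, V ⊆ U ∧ IsOpen V)
    (h : F.Visits y G) : F.Visits x G := by
  intro U hU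
  obtain ⟨V, hV, hVU, hVo⟩ := hG U hU
  obtain ⟨n, hn⟩ := (h V hV).exists
  have h1 : F.toFun^[n] ⁻¹' V ∈ 𝓝[F.X] y := F.continuousWithinAt_iterate hy n (hVo.mem_nhds hn)
  have h2 := hxy _ (mem_nhdsWithin_iff_exists_mem_nhds_inter.1 h1).choose_spec.1
  rw [← map_add_atTop_eq_nat n, frequently_map]
  refine h2.mono fun m hm => hVU ?_
  rw [add_comm, Function.iterate_add_apply]
  exact (mem_nhdsWithin_iff_exists_mem_nhds_inter.1 h1).choose_spec.2 ⟨hm, F.iterate_mem_X hx m⟩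

/-- Supplies the open-basis hypothesis of `Visits.trans`, which is stated for a general filter so
that it also applies to one-sided neighbourhoods. -/
theorem nhds_open_basis (y : ℝ) : ∀ U ∈ 𝓝 y, ∃ V ∈ 𝓝 y, V ⊆ U ∧ IsOpen V := fun _ hU =>
  let ⟨V, h1, h2, h3⟩ := mem_nhds_iff.1 hU
  ⟨V, h2.mem_nhds h3, h1, h2⟩

theorem isClosed_omegaSet (x : ℝ) : IsClosed (omegaSet F.toFun x) := isClosed_omegaLimit _ _ _

theorem omegaSet_subset_X {x : ℝ} (hx : x ∈ F.X) : omegaSet F.toFun x ⊆ F.X := fun y hy => by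
  obtain ⟨φ, -, h⟩ := mem_omegaSet_iff.1 hy
  exact F.isClosed_X.mem_of_tendsto h (Eventually.of_forall fun j => F.iterate_mem_X hx _)

theorem omegaSet_subset_of_mem {x y : ℝ} (hx : x ∈ F.X) (hy : y ∈ F.Xtilde)
    (h : y ∈ omegaSet F.toFun x) : omegaSet F.toFun y ⊆ omegaSet F.toFun x := fun z hz => by
  rw [mem_omegaSet_iff_visits] at *
  exact h.trans hx hy (nhds_open_basis z) hz

theorem apply_mem_omegaSet {x y : ℝ} (hx : x ∈ F.X) (hy : y ∉ F.Δ)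
    (h : y ∈ omegaSet F.toFun x) : F.toFun y ∈ omegaSet F.toFun x := by
  have hyX := F.omegaSet_subset_X hx h
  rw [mem_omegaSet_iff_visits] at *
  exact h.map hx (F.continuousWithinAt_of_notMem_Δ ⟨hyX, hy⟩)

theorem orbit_subset_omegaSet {x y : ℝ} (hx : x ∈ F.X) (hy : y ∈ F.Xtilde)
    (h : y ∈ omegaSet F.toFun x) : orbit F.toFun y ⊆ omegaSet F.toFun x := by
  rintro _ ⟨n, rfl⟩
  induction n with
  | zero => exact h
  | succ n ih =>
    simp only [Function.iterate_succ_apply'] at *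
    exact F.apply_mem_omegaSet hx (hy n).2 ih

theorem omegaSet_subset_closure_orbit (x : ℝ) :
    omegaSet F.toFun x ⊆ closure (orbit F.toFun x) := fun _ hy => by
  obtain ⟨φ, -, h⟩ := mem_omegaSet_iff.1 hy
  exact mem_closure_of_tendsto h (Eventually.of_forall fun j => ⟨φ j, rfl⟩)

theorem orbit_subset_Xtilde {x : ℝ} (hx : x ∈ F.Xtilde) : orbit F.toFun x ⊆ F.Xtilde := by
  rintro _ ⟨n, rfl⟩
  exact F.iterate_mem_Xtilde hx n

theorem Xtilde_disjoint_Δ {x : ℝ} (hx : x ∈ F.Xtilde) : x ∉ F.Δ := (hx 0).2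

theorem closure_orbit_eq_omegaSet {x y : ℝ} (hx : x ∈ F.X) (hy : y ∈ F.Xtilde)
    (h : y ∈ omegaSet F.toFun x) (hxy : omegaSet F.toFun x = omegaSet F.toFun y) :
    closure (orbit F.toFun y) = omegaSet F.toFun x :=
  Subset.antisymm (closure_minimal (F.orbit_subset_omegaSet hx hy h) (F.isClosed_omegaSet x))
    (hxy ▸ F.omegaSet_subset_closure_orbit y)

/-! ### Orbits that are never separated -/

theorem abs_iterate_sub_le {x y : ℝ} (hx : x ∈ F.Xtilde) (hy : y ∈ F.Xtilde)
    (h : ∀ n, F.NotSep (F.toFun^[n] x) (F.toFun^[n] y)) (n : ℕ) :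
    |F.toFun^[n] x - F.toFun^[n] y| ≤ F.lam ^ n * |x - y| := by
  induction n with
  | zero => simp
  | succ n ih =>
    rw [Function.iterate_succ_apply', Function.iterate_succ_apply', pow_succ', mul_assoc]
    exact (F.abs_sub_le_of_notSep (hx n) (hy n) (h n)).trans
      (mul_le_mul_of_nonneg_left ih F.lam_pos.le)

theorem tendsto_lam_pow_mul (C : ℝ) : Tendsto (fun n : ℕ => F.lam ^ n * C) atTop (𝓝 0) := by
  simpa using (tendsto_pow_atTop_nhds_zero_of_lt_one F.lam_pos.le F.lam_lt_one).mul_const C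

theorem omegaSet_subset_of_tendsto {x y : ℝ}
    (h : Tendsto (fun n => F.toFun^[n] x - F.toFun^[n] y) atTop (𝓝 0)) :
    omegaSet F.toFun x ⊆ omegaSet F.toFun y := fun z hz => by
  rw [mem_omegaSet_iff] at *
  obtain ⟨φ, hφ, hz⟩ := hz
  refine ⟨φ, hφ, ?_⟩
  simpa using hz.sub (h.comp hφ.tendsto_atTop)

theorem omegaSet_eq_of_notSep {x y : ℝ} (hx : x ∈ F.Xtilde) (hy : y ∈ F.Xtilde)
    (h : ∀ n, F.NotSep (F.toFun^[n] x) (F.toFun^[n] y)) :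
    omegaSet F.toFun x = omegaSet F.toFun y := by
  have key : ∀ {x y : ℝ}, x ∈ F.Xtilde → y ∈ F.Xtilde →
      (∀ n, F.NotSep (F.toFun^[n] x) (F.toFun^[n] y)) →
      omegaSet F.toFun x ⊆ omegaSet F.toFun y := fun hx hy h =>
    F.omegaSet_subset_of_tendsto <| squeeze_zero_norm (F.abs_iterate_sub_le hx hy h)
      (F.tendsto_lam_pow_mul _)
  exact (key hx hy h).antisymm (key hy hx fun n => (h n).symm)

/-- Two orbits that start closer than the distance from the second one to the
interior points of `Δ` stay together. -/
theorem notSep_iterate_of_abs_lt {x y δ : ℝ} (hx : x ∈ F.Xtilde) (hy : y ∈ F.Xtilde)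
    (hδ : ∀ n k, 1 ≤ k → k < F.N → δ ≤ |F.toFun^[n] y - F.c k|) (hxy : |x - y| < δ) (n : ℕ) :
    F.NotSep (F.toFun^[n] x) (F.toFun^[n] y) := by
  have key : ∀ n, |F.toFun^[n] x - F.toFun^[n] y| < δ →
      F.NotSep (F.toFun^[n] x) (F.toFun^[n] y) := fun n hn =>
    F.notSep_of_interior (hx n) (hy n) fun k h1 h2 => (lt_iff_lt_of_abs_lt <|
      (by rwa [abs_sub_comm] : _ < δ).trans_le (hδ n k h1 h2)).symm
  suffices h : |F.toFun^[n] x - F.toFun^[n] y| < δ from key n h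
  induction n with
  | zero => exact hxy
  | succ n ih =>
    rw [Function.iterate_succ_apply', Function.iterate_succ_apply']
    calc _ ≤ F.lam * |F.toFun^[n] x - F.toFun^[n] y| :=
          F.abs_sub_le_of_notSep (hx n) (hy n) (key n ih)
      _ ≤ 1 * |F.toFun^[n] x - F.toFun^[n] y| := by gcongr; exact F.lam_lt_one.le
      _ < δ := by rwa [one_mul]

/-! ### Periodic orbits -/

/-- The orbit and its shift by `p` approach each other like `lam ^ n`, so along each residue class
mod `p` the orbit is Cauchy. The finiteness of the limit set is used both to find periodic orbits
and, by contradiction, in `IsRecurrentSide.exists_visits_both`. -/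
theorem exists_tendsto_of_notSep {x : ℝ} (hx : x ∈ F.Xtilde) {p : ℕ} (hp : 1 ≤ p)
    (h : ∀ n, F.NotSep (F.toFun^[n + p] x) (F.toFun^[n] x)) :
    ∃ z : ℕ → ℝ, (∀ i, Tendsto (fun j => F.toFun^[j * p + i] x) atTop (𝓝 (z i))) ∧
      (∀ i, z (i + p) = z i) ∧ (range z).Finite ∧ omegaSet F.toFun x = range z := by
  set C := |F.toFun^[p] x - x| with hC
  have hb : ∀ n, |F.toFun^[n + p] x - F.toFun^[n] x| ≤ F.lam ^ n * C := fun n => by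
    have := F.abs_iterate_sub_le (F.iterate_mem_Xtilde hx p) hx
      (fun n => by rw [← Function.iterate_add_apply]; exact h n) n
    rwa [← Function.iterate_add_apply] at this
  have hr : F.lam ^ p < 1 := pow_lt_one₀ F.lam_pos.le F.lam_lt_one (by omega)
  have hd : ∀ i j, dist (F.toFun^[j * p + i] x) (F.toFun^[(j + 1) * p + i] x) ≤
      F.lam ^ i * C * (F.lam ^ p) ^ j := fun i j => by
    rw [dist_comm, Real.dist_eq, show (j + 1) * p + i = (j * p + i) + p by ring]
    refine (hb _).trans_eq ?_
    rw [pow_add, mul_comm j p, pow_mul]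
    ring
  choose z hz using fun i => cauchySeq_tendsto_of_complete (cauchySeq_of_le_geometric _ _ hr (hd i))
  have hzp : ∀ i, z (i + p) = z i := fun i => by
    refine tendsto_nhds_unique (hz (i + p)) ?_
    have := (hz i).comp (tendsto_add_atTop_nat 1)
    refine this.congr fun j => ?_
    simp only [Function.comp]
    rw [show (j + 1) * p + i = j * p + (i + p) by ring]
  have hclose : ∀ n, |F.toFun^[n] x - z n| ≤ F.lam ^ n * (C / (1 - F.lam ^ p)) := fun n => by
    have := dist_le_of_le_geometric_of_tendsto₀ _ _ hr (hd n) (hz n)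
    rw [Real.dist_eq] at this
    simpa [mul_div_assoc] using this
  have hfin : (range z).Finite := by
    refine ((Set.finite_Iio p).image z).subset ?_
    rintro _ ⟨i, rfl⟩
    refine ⟨i % p, Nat.mod_lt _ (by omega), ?_⟩
    have : ∀ k r, z (r + p * k) = z r := fun k => by
      induction k with
      | zero => simp
      | succ k ih => intro r; rw [mul_add, mul_one, ← add_assoc, hzp, ih]
    conv_rhs => rw [← Nat.mod_add_div i p, this]
  refine ⟨z, hz, hzp, hfin, Subset.antisymm ?_ ?_⟩
  · intro y hy
    obtain ⟨φ, hφ, hy⟩ := mem_omegaSet_iff.1 hy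
    have h0 : Tendsto (fun n => F.toFun^[n] x - z n) atTop (𝓝 0) :=
      squeeze_zero_norm hclose (F.tendsto_lam_pow_mul _)
    have : Tendsto (fun j => z (φ j)) atTop (𝓝 y) := by
      simpa using hy.sub (h0.comp hφ.tendsto_atTop)
    exact hfin.isClosed.mem_of_tendsto this (Eventually.of_forall fun j => mem_range_self _)
  · rintro _ ⟨i, rfl⟩
    refine mem_omegaSet_iff.2 ⟨fun j => j * p + i, fun j k hjk => ?_, hz i⟩
    have : j * p < k * p := Nat.mul_lt_mul_of_pos_right hjk hp
    simpa using this

theorem eventually_le_abs_sub_of_notMem_omegaSet {x y : ℝ} (hy : y ∉ omegaSet F.toFun x) :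
    ∀ᶠ δ : ℝ in 𝓝[>] 0, ∀ᶠ n in atTop, δ ≤ |F.toFun^[n] x - y| := by
  simp only [mem_omegaSet_iff_visits, Visits, not_forall, not_frequently] at hy
  obtain ⟨U, hU, hn⟩ := hy
  obtain ⟨δ, hδ, hb⟩ := Metric.mem_nhds_iff.1 hU
  filter_upwards [Ioo_mem_nhdsGT hδ] with δ' hδ'
  refine hn.mono fun n hn => ?_
  by_contra hlt
  exact hn (hb (by rw [Metric.mem_ball, Real.dist_eq]; linarith [hδ'.2]))

/-- From some time on the orbit stays `δ` away from `Δ`; by compactness two later iterates are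
within `δ` of each other, and from then on the orbit and its shift are never separated. -/
theorem isPeriodicOrbit_omegaSet {x : ℝ} (hx : x ∈ F.Xtilde)
    (hΔ : ∀ c ∈ F.Δ, c ∉ omegaSet F.toFun x) : F.IsPeriodicOrbit (omegaSet F.toFun x) := by
  have hxX := F.Xtilde_subset_X hx
  have h1 : ∀ᶠ δ : ℝ in 𝓝[>] 0, ∀ c ∈ F.Δ, ∀ᶠ n in atTop, δ ≤ |F.toFun^[n] x - c| :=
    (eventually_all_finite F.finite_Δ).2 fun c hc =>
      F.eventually_le_abs_sub_of_notMem_omegaSet (hΔ c hc)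
  obtain ⟨δ, h2, hδ⟩ := (h1.and self_mem_nhdsWithin).exists
  rw [← eventually_all_finite F.finite_Δ, eventually_atTop] at h2
  obtain ⟨M, hM⟩ := h2
  obtain ⟨y, -, φ, hφ, hy⟩ :=
    F.isCompact_X.tendsto_subseq fun n => F.iterate_mem_X hxX (n + M)
  obtain ⟨k, hk⟩ := Metric.cauchySeq_iff'.1 hy.cauchySeq δ hδ
  obtain ⟨p, hp⟩ := Nat.exists_eq_add_of_lt (hφ (Nat.lt_succ_self k))
  have hd := hk (k + 1) (Nat.le_succ k)
  simp only [Function.comp, Real.dist_eq] at hd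
  rw [show φ (k + 1) + M = (p + 1) + (φ k + M) by rw [← Nat.succ_eq_add_one k, hp]; ring,
    Function.iterate_add_apply] at hd
  rw [← F.omegaSet_iterate (φ k + M)] at hΔ ⊢
  have hx' := F.iterate_mem_Xtilde hx (φ k + M)
  have hfar : ∀ n, ∀ c ∈ F.Δ, δ ≤ |F.toFun^[n] (F.toFun^[φ k + M] x) - c| := fun n c hc => by
    rw [← Function.iterate_add_apply]
    exact hM _ (by omega) c hc
  generalize F.toFun^[φ k + M] x = x' at hx' hd hfar hΔ
  have hns := F.notSep_iterate_of_abs_lt (F.iterate_mem_Xtilde hx' (p + 1)) hx'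
    (fun n k h1 h2 => hfar n _ (F.c_mem_Δ h1 h2)) hd
  simp_rw [← Function.iterate_add_apply] at hns
  obtain ⟨z, hz, hzp, -, hω⟩ := F.exists_tendsto_of_notSep hx' (Nat.le_add_left 1 p) hns
  -- The limits avoid `Δ`, so `f` is continuous at them and permutes them cyclically.
  have hzX : ∀ i, z i ∈ F.X \ F.Δ := fun i => by
    have hzi : z i ∈ omegaSet F.toFun x' := hω ▸ mem_range_self i
    exact ⟨F.omegaSet_subset_X (F.Xtilde_subset_X hx') hzi, fun hc => hΔ _ hc hzi⟩
  have hzs : ∀ i, z (i + 1) = F.toFun (z i) := fun i => by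
    refine tendsto_nhds_unique (hz (i + 1)) ?_
    have hw : Tendsto (fun j => F.toFun^[j * (p + 1) + i] x') atTop (𝓝[F.X] (z i)) :=
      tendsto_nhdsWithin_iff.2
        ⟨hz i, Eventually.of_forall fun j => F.iterate_mem_X (F.Xtilde_subset_X hx') _⟩
    refine Tendsto.congr (fun j => ?_) ((F.continuousWithinAt_of_notMem_Δ (hzX i)).tendsto.comp hw)
    rw [← add_assoc, Function.iterate_succ_apply']
    rfl
  have hzi : ∀ i, z i = F.toFun^[i] (z 0) := fun i => by
    induction i with
    | zero => rfl
    | succ i ih => rw [hzs, ih, Function.iterate_succ_apply']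
  have hrange : range z = orbit F.toFun (z 0) := by
    rw [orbit]; congr 1; funext i; exact hzi i
  rw [hω]
  refine ⟨?_, z 0, ⟨p + 1, Nat.succ_pos p, ?_⟩, hrange⟩
  · rw [hrange]
    exact F.orbit_subset_Xtilde fun n => hzi n ▸ hzX n
  · have := hzp 0
    rw [zero_add, hzi (p + 1)] at this
    exact this

variable {F}

theorem IsPeriodicOrbit.finite {A : Set ℝ} (hA : F.IsPeriodicOrbit A) : A.Finite := by
  obtain ⟨-, x, ⟨p, hp, hx⟩, rfl⟩ := hA
  refine ((Set.finite_Iio p).image fun n => F.toFun^[n] x).subset ?_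
  rintro _ ⟨n, rfl⟩
  exact ⟨n % p, Nat.mod_lt _ hp, hx.iterate_mod_apply n⟩

theorem IsPeriodicOrbit.nonempty {A : Set ℝ} (hA : F.IsPeriodicOrbit A) : A.Nonempty := by
  obtain ⟨-, x, -, rfl⟩ := hA
  exact ⟨x, 0, rfl⟩

theorem IsPeriodicOrbit.orbit_subset {A : Set ℝ} (hA : F.IsPeriodicOrbit A) {z : ℝ} (hz : z ∈ A) :
    orbit F.toFun z ⊆ A := by
  obtain ⟨-, x, -, rfl⟩ := hA
  obtain ⟨k, rfl⟩ := hz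
  rintro _ ⟨n, rfl⟩
  exact ⟨n + k, Function.iterate_add_apply _ _ _ _⟩

theorem IsPeriodicOrbit.omegaSet_eq {A : Set ℝ} (hA : F.IsPeriodicOrbit A) {z : ℝ} (hz : z ∈ A) :
    omegaSet F.toFun z = A := by
  refine Subset.antisymm ((F.omegaSet_subset_closure_orbit z).trans
    (closure_minimal (hA.orbit_subset hz) hA.finite.isClosed)) ?_
  obtain ⟨-, x, ⟨p, hp, hx⟩, rfl⟩ := hA
  obtain ⟨k, rfl⟩ := hz
  simp only [F.omegaSet_iterate]
  rintro _ ⟨n, rfl⟩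
  refine mem_omegaSet_iff.2 ⟨fun j => n + j * p, fun i j hij => ?_, ?_⟩
  · have : i * p < j * p := Nat.mul_lt_mul_of_pos_right hij hp
    simpa using this
  · refine tendsto_const_nhds.congr fun j => ?_
    rw [Function.iterate_add_apply, (hx.const_mul j).eq]

/-- A periodic orbit in `X̃` attracts every orbit of `X̃` that accumulates at it. -/
theorem IsPeriodicOrbit.omegaSet_eq_of_mem {A : Set ℝ} (hA : F.IsPeriodicOrbit A) {x z : ℝ}
    (hx : x ∈ F.Xtilde) (hz : z ∈ A) (hzx : z ∈ omegaSet F.toFun x) :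
    omegaSet F.toFun x = A := by
  have h1 : ∀ᶠ δ : ℝ in 𝓝[>] 0, ∀ a ∈ A, ∀ c ∈ F.Δ, δ ≤ |a - c| := by
    rw [eventually_all_finite hA.finite]
    intro a ha
    obtain ⟨δ, hδ, h⟩ := F.exists_pos_Δ_far (hA.1 ha 0).2
    filter_upwards [Ioo_mem_nhdsGT hδ] with δ' hδ' c hc
    exact hδ'.2.le.trans (h c hc)
  -- `δ` is a lower bound for the distance from `A` to `Δ`; once the orbit of `x` comes within `δ`
  -- of `z`, `Δ` can no longer separate the two orbits.
  obtain ⟨δ, h2, hδ⟩ := (h1.and self_mem_nhdsWithin).exists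
  obtain ⟨m, hm⟩ := (F.mem_omegaSet_iff_visits.1 hzx _ (Metric.ball_mem_nhds z hδ)).exists
  rw [← F.omegaSet_iterate m, ← hA.omegaSet_eq hz]
  exact F.omegaSet_eq_of_notSep (F.iterate_mem_Xtilde hx m) (hA.1 hz)
    (F.notSep_iterate_of_abs_lt (F.iterate_mem_Xtilde hx m) (hA.1 hz)
      (fun n k h1 h3 => h2 _ (hA.orbit_subset hz ⟨n, rfl⟩) _ (F.c_mem_Δ h1 h3)) hm)

variable (F)

/-! ### One-sided limits -/

theorem tendsto_rightLim {i : ℕ} (hi : i < F.N) {a : ℝ} (ha : F.c i ≤ a) (ha' : a < F.c (i + 1)) :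
    Tendsto F.toFun (𝓝[>] a) (𝓝 (Function.rightLim F.toFun a)) := by
  obtain ⟨y, hy⟩ := F.exists_tendsto_piece hi a
  refine tendsto_rightLim_of_tendsto ⟨y, ?_⟩
  rw [← nhdsWithin_Ioo_eq_nhdsGT ha']
  exact hy.mono_left
    (nhdsWithin_mono _ ((Ioo_subset_Ioo_left ha).trans (F.Ioo_subset_piece hi)))

theorem tendsto_leftLim {i : ℕ} (hi : i < F.N) {b : ℝ} (hb : F.c i < b) (hb' : b ≤ F.c (i + 1)) :
    Tendsto F.toFun (𝓝[<] b) (𝓝 (Function.leftLim F.toFun b)) := by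
  obtain ⟨y, hy⟩ := F.exists_tendsto_piece hi b
  refine tendsto_leftLim_of_tendsto ⟨y, ?_⟩
  rw [← nhdsWithin_Ioo_eq_nhdsLT hb]
  exact hy.mono_left
    (nhdsWithin_mono _ ((Ioo_subset_Ioo_right hb').trans (F.Ioo_subset_piece hi)))

theorem tendsto_nhdsGT_of_notMem_Δ {a : ℝ} (ha : a ∈ F.X \ F.Δ) (ha' : a < F.c F.N) :
    Tendsto F.toFun (𝓝[>] a) (𝓝 (F.toFun a)) := by
  rw [← nhdsWithin_Ioo_eq_nhdsGT ha']
  exact (F.continuousWithinAt_of_notMem_Δ ha).tendsto.mono_left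
    (nhdsWithin_mono _ fun y hy => ⟨ha.1.1.trans hy.1.le, hy.2.le⟩)

theorem tendsto_nhdsLT_of_notMem_Δ {a : ℝ} (ha : a ∈ F.X \ F.Δ) (ha' : F.c 0 < a) :
    Tendsto F.toFun (𝓝[<] a) (𝓝 (F.toFun a)) := by
  rw [← nhdsWithin_Ioo_eq_nhdsLT ha']
  exact (F.continuousWithinAt_of_notMem_Δ ha).tendsto.mono_left
    (nhdsWithin_mono _ fun y hy => ⟨hy.1.le, hy.2.le.trans ha.1.2⟩)

theorem rightLim_eq_of_notMem_Δ {a : ℝ} (ha : a ∈ F.X \ F.Δ) (ha' : a < F.c F.N) :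
    Function.rightLim F.toFun a = F.toFun a :=
  rightLim_eq_of_tendsto (F.tendsto_nhdsGT_of_notMem_Δ ha ha')

theorem leftLim_eq_of_notMem_Δ {a : ℝ} (ha : a ∈ F.X \ F.Δ) (ha' : F.c 0 < a) :
    Function.leftLim F.toFun a = F.toFun a :=
  leftLim_eq_of_tendsto (F.tendsto_nhdsLT_of_notMem_Δ ha ha')

theorem _root_.mem_uIcc_of_tendsto {ι : Type*} {l : Filter ι} [l.NeBot] {s t : ι → ℝ}
    {s₀ t₀ v : ℝ} (hs : Tendsto s l (𝓝 s₀)) (ht : Tendsto t l (𝓝 t₀))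
    (h : ∀ᶠ y in l, v ∈ uIcc (s y) (t y)) : v ∈ uIcc s₀ t₀ :=
  ⟨le_of_tendsto (hs.min ht) (h.mono fun _ hy => hy.1),
    ge_of_tendsto (hs.max ht) (h.mono fun _ hy => hy.2)⟩

/-- A continuous injective map of an interval is strictly monotone; `uIcc` treats the increasing and
the decreasing case at once. -/
theorem mem_uIcc_of_mem_piece {i : ℕ} (hi : i < F.N) (hinj : InjOn F.toFun (F.piece i))
    {u v w : ℝ} (hu : F.c i < u) (hw : w < F.c (i + 1)) (huv : u ≤ v) (hvw : v ≤ w) :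
    F.toFun v ∈ uIcc (F.toFun u) (F.toFun w) := by
  have hsub : Icc u w ⊆ F.piece i := fun y hy =>
    F.Ioo_subset_piece hi ⟨hu.trans_le hy.1, hy.2.trans_lt hw⟩
  have hcont : ContinuousOn F.toFun (Icc u w) := fun y hy =>
    (F.continuousWithinAt_of_notMem_Δ (F.piece_subset hi (hsub hy))).mono
      (hsub.trans fun y hy => (F.piece_subset hi hy).1)
  have hm : v ∈ Icc u w := ⟨huv, hvw⟩
  have hl : u ∈ Icc u w := ⟨le_rfl, huv.trans hvw⟩
  have hr : w ∈ Icc u w := ⟨huv.trans hvw, le_rfl⟩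
  rcases hcont.strictMonoOn_of_injOn_Icc' (huv.trans hvw) (hinj.mono hsub) with h | h
  · exact mem_uIcc_of_le (h.monotoneOn hl hm huv) (h.monotoneOn hm hr hvw)
  · exact mem_uIcc_of_ge (h.antitoneOn hm hr hvw) (h.antitoneOn hl hm huv)

section Edge

variable {i : ℕ} (hi : i < F.N) {a b : ℝ} (ha : F.c i ≤ a) (hab : a < b) (hb : b ≤ F.c (i + 1))
include hi ha hab hb

/-- Monotonicity inside the piece passes to the limit, first at `a`, then at `b`. When `u` is itself
an end point outside `Δ`, its value is the one-sided limit. -/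
theorem mem_uIcc_rightLim_leftLim (hinj : InjOn F.toFun (F.piece i)) {u : ℝ} (hu : u ∈ Icc a b)
    (huΔ : u ∉ F.Δ) :
    F.toFun u ∈ uIcc (Function.rightLim F.toFun a) (Function.leftLim F.toFun b) := by
  have hX : u ∈ F.X := ⟨((F.c_le_c (Nat.zero_le _) hi.le).trans ha).trans hu.1,
    (hu.2.trans hb).trans (F.c_le_c hi le_rfl)⟩
  rcases hu.1.eq_or_lt with rfl | h1
  · rw [F.rightLim_eq_of_notMem_Δ ⟨hX, huΔ⟩ ((hab.trans_le hb).trans_le (F.c_le_c hi le_rfl))]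
    exact left_mem_uIcc
  rcases hu.2.eq_or_lt with rfl | h2
  · rw [F.leftLim_eq_of_notMem_Δ ⟨hX, huΔ⟩
      (((F.c_le_c (Nat.zero_le _) hi.le).trans ha).trans_lt hab)]
    exact right_mem_uIcc
  have hra := F.tendsto_rightLim hi ha (hab.trans_le hb)
  have hlb := F.tendsto_leftLim hi (ha.trans_lt hab) hb
  refine mem_uIcc_of_tendsto tendsto_const_nhds hlb ?_
  filter_upwards [Ioo_mem_nhdsLT h2] with w hw
  refine mem_uIcc_of_tendsto hra tendsto_const_nhds ?_
  filter_upwards [Ioo_mem_nhdsGT h1] with y hy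
  exact F.mem_uIcc_of_mem_piece hi hinj (ha.trans_lt hy.1) (hw.2.trans_le hb) hy.2.le hw.1.le

/-- Equality would squeeze `f` to a constant on `Ioo a b`, against injectivity. This keeps the
intervals covering the attractor nondegenerate. -/
theorem rightLim_ne_leftLim (hinj : InjOn F.toFun (F.piece i)) :
    Function.rightLim F.toFun a ≠ Function.leftLim F.toFun b := by
  intro he
  have key : ∀ u ∈ Ioo a b, F.toFun u = Function.rightLim F.toFun a := fun u hu => by
    have := F.mem_uIcc_rightLim_leftLim hi ha hab hb hinj (Ioo_subset_Icc_self hu)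
      (F.piece_subset hi (F.Ioo_subset_piece hi ⟨ha.trans_lt hu.1, hu.2.trans_le hb⟩)).2
    rwa [← he, uIcc_self] at this
  obtain ⟨u, hu⟩ := exists_between hab
  obtain ⟨v, hv⟩ := exists_between hu.2
  refine hv.1.ne (hinj (F.Ioo_subset_piece hi ⟨ha.trans_lt hu.1, hu.2.trans_le hb⟩)
    (F.Ioo_subset_piece hi ⟨(ha.trans_lt hu.1).trans hv.1, hv.2.trans_le hb⟩) ?_)
  rw [key u hu, key v ⟨hu.1.trans hv.1, hv.2⟩]

theorem abs_rightLim_sub_leftLim_le :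
    |Function.rightLim F.toFun a - Function.leftLim F.toFun b| ≤ F.lam * (b - a) := by
  have hra := F.tendsto_rightLim hi ha (hab.trans_le hb)
  have hlb := F.tendsto_leftLim hi (ha.trans_lt hab) hb
  refine le_of_tendsto (hra.sub_const _).abs ?_
  filter_upwards [Ioo_mem_nhdsGT hab] with y hy
  refine le_of_tendsto (hlb.const_sub _).abs ?_
  filter_upwards [Ioo_mem_nhdsLT hy.2] with w hw
  refine (F.abs_sub_le_of_mem_piece hi
    (F.Ioo_subset_piece hi ⟨ha.trans_lt hy.1, hy.2.trans_le hb⟩)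
    (F.Ioo_subset_piece hi ⟨(ha.trans_lt hy.1).trans hw.1, hw.2.trans_le hb⟩)).trans ?_
  rw [abs_sub_comm, abs_of_pos (sub_pos.2 hw.1)]
  have := F.lam_pos
  gcongr
  · exact hw.2.le
  · exact hy.1.le

end Edge

/-! ### One-sided accumulation at `Δ` -/

/-- The one-sided neighbourhoods of `c`: on the right for `true`, on the left for `false`. -/
def side (c : ℝ) : Bool → Filter ℝ
  | true => 𝓝[>] c
  | false => 𝓝[<] c

/-- The one-sided limits of the map. -/
noncomputable def sideLim (c : ℝ) : Bool → ℝ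
  | true => Function.rightLim F.toFun c
  | false => Function.leftLim F.toFun c

theorem side_le_nhds (c : ℝ) (b : Bool) : side c b ≤ 𝓝 c := by
  cases b <;> exact nhdsWithin_le_nhds

theorem side_open_basis (c : ℝ) (b : Bool) :
    ∀ U ∈ side c b, ∃ V ∈ side c b, V ⊆ U ∧ IsOpen V := by
  intro U hU
  cases b
  · obtain ⟨l, hl, h⟩ := (mem_nhdsLT_iff_exists_Ioo_subset' (sub_one_lt c)).1 hU
    exact ⟨_, Ioo_mem_nhdsLT hl, h, isOpen_Ioo⟩
  · obtain ⟨l, hl, h⟩ := (mem_nhdsGT_iff_exists_Ioo_subset' (lt_add_one c)).1 hU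
    exact ⟨_, Ioo_mem_nhdsGT hl, h, isOpen_Ioo⟩

variable {F}

/-- An orbit in `X` cannot visit the outer side of `c 0` or `c N`, so every visited side is one
where the limit exists and is counted in `D`. -/
theorem Visits.sideLim_spec {x c : ℝ} {b : Bool} (hx : x ∈ F.X) (hc : c ∈ F.Δ)
    (h : F.Visits x (side c b)) :
    F.sideLim c b ∈ F.D ∧ Tendsto F.toFun (side c b) (𝓝 (F.sideLim c b)) := by
  obtain ⟨k, hk, rfl⟩ := F.exists_eq_c_of_mem_Δ hc
  cases b
  · obtain ⟨n, hn⟩ := (h (Iio (F.c k)) self_mem_nhdsWithin).exists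
    have hk1 : 1 ≤ k := by
      rcases Nat.eq_zero_or_pos k with rfl | h0
      · exact absurd hn (not_lt.2 (F.iterate_mem_X hx n).1)
      · exact h0
    exact ⟨Or.inl ⟨k, hk1, hk, rfl⟩, F.tendsto_dMinus hk1 hk⟩
  · obtain ⟨n, hn⟩ := (h (Ioi (F.c k)) self_mem_nhdsWithin).exists
    have hk1 : k < F.N := by
      rcases hk.lt_or_eq with h0 | rfl
      · exact h0
      · exact absurd hn (not_lt.2 (F.iterate_mem_X hx n).2)
    exact ⟨Or.inr ⟨k, hk1, rfl⟩, F.tendsto_dPlus hk1⟩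

theorem Visits.sideLim_mem_omegaSet {x c : ℝ} {b : Bool} (hx : x ∈ F.X) (hc : c ∈ F.Δ)
    (h : F.Visits x (side c b)) : F.sideLim c b ∈ omegaSet F.toFun x := by
  rw [mem_omegaSet_iff_visits]
  exact h.map hx ((h.sideLim_spec hx hc).2.mono_left inf_le_left)

theorem Visits.mem_omegaSet {x c : ℝ} {b : Bool} (h : F.Visits x (side c b)) :
    c ∈ omegaSet F.toFun x :=
  F.mem_omegaSet_iff_visits.2 (h.mono (side_le_nhds c b))

variable (F)

/-- An orbit in `X̃` never equals `c`, so accumulation at `c` must come from one of the two sides.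
-/
theorem exists_visits_side {x c : ℝ} (hx : x ∈ F.Xtilde) (hc : c ∈ F.Δ)
    (h : c ∈ omegaSet F.toFun x) : ∃ b, F.Visits x (side c b) := by
  rw [mem_omegaSet_iff_visits] at h
  have h1 : F.Visits x (𝓝[<] c ⊔ 𝓝[>] c) := by
    rw [nhdsLT_sup_nhdsGT]
    intro U hU
    refine (h _ (mem_nhdsWithin_iff_exists_mem_nhds_inter.1 hU).choose_spec.1).mono fun n hn => ?_
    exact (mem_nhdsWithin_iff_exists_mem_nhds_inter.1 hU).choose_spec.2
      ⟨hn, fun e => (hx n).2 (by rwa [show F.toFun^[n] x = c from e])⟩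
  rcases F.visits_of_visits_sup h1 with h | h
  · exact ⟨false, h⟩
  · exact ⟨true, h⟩

/-! ### Trapping of orbits that visit a recurrent side. -/

/-- The orbits of the one-sided limits at the points of `Δ` where the orbit of `d`
accumulates. -/
def limitOrbits (d : ℝ) : Set ℝ :=
  {p | ∃ c ∈ F.Δ, ∃ b, F.Visits d (side c b) ∧ p ∈ orbit F.toFun (F.sideLim c b)}

variable {F}

theorem apply_mem_limitOrbits {d p : ℝ} (hp : p ∈ F.limitOrbits d) :
    F.toFun p ∈ F.limitOrbits d := by
  obtain ⟨c, hc, b, hv, n, rfl⟩ := hp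
  exact ⟨c, hc, b, hv, n + 1, Function.iterate_succ_apply' _ _ _⟩

theorem limitOrbits_subset_Xtilde (hD : F.D ⊆ F.Xtilde) {d : ℝ} (hd : d ∈ F.X) :
    F.limitOrbits d ⊆ F.Xtilde := by
  rintro p ⟨c, hc, b, hv, h⟩
  exact F.orbit_subset_Xtilde (hD (hv.sideLim_spec hd hc).1) h

theorem limitOrbits_subset_omegaSet (hD : F.D ⊆ F.Xtilde) {d : ℝ} (hd : d ∈ F.X) :
    F.limitOrbits d ⊆ omegaSet F.toFun d := by
  rintro p ⟨c, hc, b, hv, h⟩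
  exact F.orbit_subset_omegaSet hd (hD (hv.sideLim_spec hd hc).1)
    (hv.sideLim_mem_omegaSet hd hc) h

variable (F)

theorem visits_of_mem_omegaSet {d p : ℝ} (hp : p ∈ omegaSet F.toFun d) {U : Set ℝ} (hU : IsOpen U)
    (hpU : p ∈ U) : ∃ᶠ n in atTop, F.toFun^[n] d ∈ U :=
  F.mem_omegaSet_iff_visits.1 hp U (hU.mem_nhds hpU)

/-- A scale at which nearness to `Δ` within `ω(d)` means accumulation. -/
theorem exists_scale (d : ℝ) : ∃ ε > 0,
    (∀ c ∈ F.Δ, ∀ c' ∈ F.Δ, |c - c'| < ε → c = c') ∧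
    ∀ c ∈ F.Δ, ∀ p ∈ omegaSet F.toFun d,
      (p ∈ Ioo c (c + ε) → F.Visits d (side c true)) ∧
      (p ∈ Ioo (c - ε) c → F.Visits d (side c false)) := by
  obtain ⟨ε₀, hε₀, hsep⟩ := F.finite_Δ.exists_pos_separated
  have h1 : ∀ᶠ ε : ℝ in 𝓝[>] 0, ∀ c ∈ F.Δ, ∀ p ∈ omegaSet F.toFun d,
      (p ∈ Ioo c (c + ε) → F.Visits d (side c true)) ∧
      (p ∈ Ioo (c - ε) c → F.Visits d (side c false)) := by
    rw [eventually_all_finite F.finite_Δ]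
    intro c hc
    have hr : ∀ᶠ ε : ℝ in 𝓝[>] 0, ∀ p ∈ omegaSet F.toFun d,
        p ∈ Ioo c (c + ε) → F.Visits d (side c true) := by
      -- If the orbit of `d` eventually avoids a right neighbourhood of `c`, then `ω(d)` does not
      -- meet that neighbourhood, and any smaller `ε` works.
      by_cases hv : F.Visits d (side c true)
      · exact Eventually.of_forall fun _ _ _ _ => hv
      · simp only [Visits, not_forall] at hv
        obtain ⟨U, hU, hn⟩ := hv
        obtain ⟨l, hl, h⟩ := (mem_nhdsGT_iff_exists_Ioo_subset' (lt_add_one c)).1 hU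
        filter_upwards [Ioo_mem_nhdsGT (sub_pos.2 hl)] with ε hε p hp hpc
        refine absurd ((F.visits_of_mem_omegaSet hp isOpen_Ioo hpc).mono fun n hn => h ?_) hn
        exact ⟨hn.1, by linarith [hn.2, hε.2]⟩
    have hl : ∀ᶠ ε : ℝ in 𝓝[>] 0, ∀ p ∈ omegaSet F.toFun d,
        p ∈ Ioo (c - ε) c → F.Visits d (side c false) := by
      by_cases hv : F.Visits d (side c false)
      · exact Eventually.of_forall fun _ _ _ _ => hv
      · simp only [Visits, not_forall] at hv
        obtain ⟨U, hU, hn⟩ := hv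
        obtain ⟨l, hl, h⟩ := (mem_nhdsLT_iff_exists_Ioo_subset' (sub_one_lt c)).1 hU
        filter_upwards [Ioo_mem_nhdsGT (sub_pos.2 hl)] with ε hε p hp hpc
        refine absurd ((F.visits_of_mem_omegaSet hp isOpen_Ioo hpc).mono fun n hn => h ?_) hn
        exact ⟨by linarith [hn.1, hε.2], hn.2⟩
    filter_upwards [hr, hl] with ε h1 h2 p hp
    exact ⟨h1 p hp, h2 p hp⟩
  obtain ⟨ε, h2, hε⟩ := (h1.and (Ioo_mem_nhdsGT hε₀)).exists
  exact ⟨ε, hε.1, fun c hc c' hc' h => hsep c hc c' hc' (h.trans hε.2), h2⟩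

/-- An interval with no point of `Δ` inside, each end point of which is either in `limitOrbits d`
or a point of `Δ` at which the orbit of `d` accumulates from inside the interval. -/
structure IsTrap (d a b : ℝ) : Prop where
  lt : a < b
  left : a ∈ F.limitOrbits d ∨ a ∈ F.Δ ∧ F.Visits d (side a true)
  right : b ∈ F.limitOrbits d ∨ b ∈ F.Δ ∧ F.Visits d (side b false)
  notMem : ∀ c ∈ F.Δ, c ∉ Ioo a b

variable {F}

theorem IsTrap.left_mem_omegaSet (hD : F.D ⊆ F.Xtilde) {d a b : ℝ} (hd : d ∈ F.X)
    (h : F.IsTrap d a b) : a ∈ omegaSet F.toFun d :=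
  h.left.elim (fun h => limitOrbits_subset_omegaSet hD hd h) fun h => h.2.mem_omegaSet

theorem IsTrap.right_mem_omegaSet (hD : F.D ⊆ F.Xtilde) {d a b : ℝ} (hd : d ∈ F.X)
    (h : F.IsTrap d a b) : b ∈ omegaSet F.toFun d :=
  h.right.elim (fun h => limitOrbits_subset_omegaSet hD hd h) fun h => h.2.mem_omegaSet

/-- Being shorter than `ε`, the interval has at most one point `c` of `Δ` inside. Keep the part
containing `v`: its other end lies in `ω(d)` within `ε` of `c`, so by the choice of scale the orbit
of `d` visits `c` from that part. -/
theorem isTrap_of_mem_Ioo (hD : F.D ⊆ F.Xtilde) {d ε : ℝ} (hd : d ∈ F.X)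
    (hsep : ∀ c ∈ F.Δ, ∀ c' ∈ F.Δ, |c - c'| < ε → c = c')
    (hscale : ∀ c ∈ F.Δ, ∀ p ∈ omegaSet F.toFun d,
      (p ∈ Ioo c (c + ε) → F.Visits d (side c true)) ∧
      (p ∈ Ioo (c - ε) c → F.Visits d (side c false)))
    {a b v : ℝ} (ha : a ∈ F.limitOrbits d) (hb : b ∈ F.limitOrbits d) (hv : v ∈ Ioo a b)
    (hvΔ : v ∉ F.Δ) (hab : b - a < ε) :
    ∃ a' b', F.IsTrap d a' b' ∧ b' - a' ≤ b - a ∧ v ∈ Ioo a' b' := by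
  by_cases h : ∀ c ∈ F.Δ, c ∉ Ioo a b
  · exact ⟨a, b, ⟨hv.1.trans hv.2, Or.inl ha, Or.inl hb, h⟩, le_rfl, hv⟩
  push Not at h
  obtain ⟨c, hc, hcab⟩ := h
  have hu : ∀ c' ∈ F.Δ, c' ∈ Ioo a b → c = c' := fun c' hc' h => by
    refine hsep c hc c' hc' (abs_lt.2 ⟨?_, ?_⟩) <;> linarith [hcab.1, hcab.2, h.1, h.2]
  rcases lt_or_gt_of_ne (fun e => hvΔ (e ▸ hc) : v ≠ c) with hlt | hlt
  · refine ⟨a, c, ⟨hcab.1, Or.inl ha, Or.inr ⟨hc, ?_⟩, ?_⟩, by linarith [hcab.2], hv.1, hlt⟩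
    · exact (hscale c hc a (limitOrbits_subset_omegaSet hD hd ha)).2
        ⟨by linarith [hcab.2], hcab.1⟩
    · exact fun c' hc' h => h.2.ne' (hu c' hc' ⟨h.1, h.2.trans hcab.2⟩)
  · refine ⟨c, b, ⟨hcab.2, Or.inr ⟨hc, ?_⟩, Or.inl hb, ?_⟩, by linarith [hcab.1], hlt, hv.2⟩
    · exact (hscale c hc b (limitOrbits_subset_omegaSet hD hd hb)).1
        ⟨hcab.2, by linarith [hcab.1]⟩
    · exact fun c' hc' h => h.1.ne (hu c' hc' ⟨hcab.1.trans h.1, h.2⟩)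

/-- The one-sided limits at both ends lie in `limitOrbits d`, and `f u` is strictly between them
because it is not in `limitOrbits d`. The image interval is shorter than `ε`, so `isTrap_of_mem_Ioo`
applies to it. -/
theorem IsTrap.step (hinj : ∀ i < F.N, InjOn F.toFun (F.piece i)) (hD : F.D ⊆ F.Xtilde)
    {d ε : ℝ} (hd : d ∈ F.X)
    (hsep : ∀ c ∈ F.Δ, ∀ c' ∈ F.Δ, |c - c'| < ε → c = c')
    (hscale : ∀ c ∈ F.Δ, ∀ p ∈ omegaSet F.toFun d,
      (p ∈ Ioo c (c + ε) → F.Visits d (side c true)) ∧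
      (p ∈ Ioo (c - ε) c → F.Visits d (side c false)))
    {a b u : ℝ} (h : F.IsTrap d a b) (hab : b - a ≤ ε) (hu : u ∈ F.Xtilde) (huab : u ∈ Ioo a b)
    (hfu : F.toFun u ∉ F.limitOrbits d) :
    ∃ a' b', F.IsTrap d a' b' ∧ b' - a' ≤ F.lam * (b - a) ∧ F.toFun u ∈ Ioo a' b' := by
  have haX := F.omegaSet_subset_X hd (h.left_mem_omegaSet hD hd)
  have hbX := F.omegaSet_subset_X hd (h.right_mem_omegaSet hD hd)
  obtain ⟨i, hi, ha, hb⟩ := F.exists_c_le_and_le_c haX hbX h.lt h.notMem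
  have hr : Function.rightLim F.toFun a ∈ F.limitOrbits d := by
    rcases h.left with h' | ⟨h1, h2⟩
    · rw [F.rightLim_eq_of_notMem_Δ (a := a) (limitOrbits_subset_Xtilde hD hd h' 0)
        (h.lt.trans_le hbX.2)]
      exact apply_mem_limitOrbits h'
    · exact ⟨a, h1, true, h2, 0, rfl⟩
  have hl : Function.leftLim F.toFun b ∈ F.limitOrbits d := by
    rcases h.right with h' | ⟨h1, h2⟩
    · rw [F.leftLim_eq_of_notMem_Δ (a := b) (limitOrbits_subset_Xtilde hD hd h' 0)
        (haX.1.trans_lt h.lt)]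
      exact apply_mem_limitOrbits h'
    · exact ⟨b, h1, false, h2, 0, rfl⟩
  have hm := F.mem_uIcc_rightLim_leftLim hi ha h.lt hb (hinj i hi) (Ioo_subset_Icc_self huab) (hu 0).2
  have hle := F.abs_rightLim_sub_leftLim_le hi ha h.lt hb
  have hlt : F.lam * (b - a) < ε :=
    (mul_lt_of_lt_one_left (sub_pos.2 h.lt) F.lam_lt_one).trans_le hab
  generalize Function.rightLim F.toFun a = a₁ at *
  generalize Function.leftLim F.toFun b = b₁ at *
  have hfΔ : F.toFun u ∉ F.Δ := (hu 1).2
  have hna : F.toFun u ≠ a₁ := fun e => hfu (e ▸ hr)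
  have hnb : F.toFun u ≠ b₁ := fun e => hfu (e ▸ hl)
  rcases le_total a₁ b₁ with h0 | h0
  · rw [uIcc_of_le h0] at hm
    rw [abs_sub_comm, abs_of_nonneg (sub_nonneg.2 h0)] at hle
    obtain ⟨a', b', h1, h2, h3⟩ := isTrap_of_mem_Ioo hD hd hsep hscale hr hl
      ⟨lt_of_le_of_ne hm.1 hna.symm, lt_of_le_of_ne hm.2 hnb⟩ hfΔ (hle.trans_lt hlt)
    exact ⟨a', b', h1, h2.trans hle, h3⟩
  · rw [uIcc_of_ge h0] at hm
    rw [abs_of_nonneg (sub_nonneg.2 h0)] at hle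
    obtain ⟨a', b', h1, h2, h3⟩ := isTrap_of_mem_Ioo hD hd hsep hscale hl hr
      ⟨lt_of_le_of_ne hm.1 hnb.symm, lt_of_le_of_ne hm.2 hna⟩ hfΔ (hle.trans_lt hlt)
    exact ⟨a', b', h1, h2.trans hle, h3⟩

/-- The trap lies between `c` and an iterate of the one-sided limit close to `c` on the recurrent
side; recurrence puts the whole orbit of this limit in `limitOrbits`. -/
theorem exists_isTrap {x c ε : ℝ} {b : Bool} (hc : c ∈ F.Δ) (hε : 0 < ε)
    (hsep : ∀ c ∈ F.Δ, ∀ c' ∈ F.Δ, |c - c'| < ε → c = c')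
    (hd : F.sideLim c b ∈ F.X)
    (hr : F.Visits (F.sideLim c b) (side c b)) (hv : F.Visits x (side c b)) :
    ∃ a' b' m, F.IsTrap (F.sideLim c b) a' b' ∧ b' - a' ≤ ε ∧ F.toFun^[m] x ∈ Ioo a' b' := by
  cases b
  · obtain ⟨n, hn⟩ := (hr _ (Ioo_mem_nhdsLT (sub_lt_self c hε))).exists
    obtain ⟨m, hm⟩ := (hv _ (Ioo_mem_nhdsLT hn.2)).exists
    refine ⟨_, _, m, ⟨hn.2, Or.inl ⟨c, hc, false, hr, n, rfl⟩, Or.inr ⟨hc, hr⟩, ?_⟩,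
      by linarith [hn.1], hm⟩
    intro c' hc' h
    refine h.2.ne' (hsep c hc c' hc' (abs_lt.2 ⟨?_, ?_⟩)) <;> linarith [h.1, h.2, hn.1]
  · obtain ⟨n, hn⟩ := (hr _ (Ioo_mem_nhdsGT (lt_add_of_pos_right c hε))).exists
    obtain ⟨m, hm⟩ := (hv _ (Ioo_mem_nhdsGT hn.1)).exists
    refine ⟨_, _, m, ⟨hn.1, Or.inr ⟨hc, hr⟩, Or.inl ⟨c, hc, true, hr, n, rfl⟩, ?_⟩,
      by linarith [hn.2], hm⟩
    intro c' hc' h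
    refine h.1.ne (hsep c hc c' hc' (abs_lt.2 ⟨?_, ?_⟩)) <;> linarith [h.1, h.2, hn.2]

/-- If a one-sided limit at a point of `Δ` has an orbit that accumulates at that point from the
same side, then it determines the limit set of each orbit that accumulates there. -/
theorem omegaSet_eq_omegaSet_sideLim (hinj : ∀ i < F.N, InjOn F.toFun (F.piece i))
    (hD : F.D ⊆ F.Xtilde) {x c : ℝ} {b : Bool} (hx : x ∈ F.Xtilde) (hc : c ∈ F.Δ)
    (hr : F.Visits (F.sideLim c b) (side c b)) (hv : F.Visits x (side c b)) :
    omegaSet F.toFun x = omegaSet F.toFun (F.sideLim c b) := by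
  have hxX := F.Xtilde_subset_X hx
  have hdt : F.sideLim c b ∈ F.Xtilde := hD (hv.sideLim_spec hxX hc).1
  have hd := F.Xtilde_subset_X hdt
  refine Subset.antisymm ?_ (F.omegaSet_subset_of_mem hxX hdt (hv.sideLim_mem_omegaSet hxX hc))
  -- If the orbit of `x` hits `limitOrbits`, it continues inside `ω(d)` and the inclusion is
  -- immediate; otherwise it always stays strictly inside the traps.
  by_cases hP : ∃ n, F.toFun^[n] x ∈ F.limitOrbits (F.sideLim c b)
  · obtain ⟨n, hn⟩ := hP
    rw [← F.omegaSet_iterate n]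
    exact F.omegaSet_subset_of_mem hd (limitOrbits_subset_Xtilde hD hd hn)
      (limitOrbits_subset_omegaSet hD hd hn)
  push Not at hP
  obtain ⟨ε, hε, hsep, hscale⟩ := F.exists_scale (F.sideLim c b)
  obtain ⟨a₀, b₀, m, h0, hab0, hm⟩ := exists_isTrap hc hε hsep hd hr hv
  have key : ∀ n, ∃ a' b', F.IsTrap (F.sideLim c b) a' b' ∧ b' - a' ≤ F.lam ^ n * ε ∧
      F.toFun^[n] (F.toFun^[m] x) ∈ Ioo a' b' := fun n => by
    induction n with
    | zero => exact ⟨a₀, b₀, h0, by simpa using hab0, hm⟩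
    | succ n ih =>
      obtain ⟨a', b', h, hab, hn⟩ := ih
      have hle : F.lam ^ n * ε ≤ ε :=
        mul_le_of_le_one_left hε.le (pow_le_one₀ F.lam_pos.le F.lam_lt_one.le)
      have hnP := hP (n + 1 + m)
      rw [Function.iterate_add_apply, Function.iterate_succ_apply'] at hnP
      obtain ⟨a'', b'', h2, hab2, hn2⟩ := h.step hinj hD hd hsep hscale (hab.trans hle)
        (F.iterate_mem_Xtilde (F.iterate_mem_Xtilde hx m) n) hn hnP
      refine ⟨a'', b'', h2, hab2.trans ?_, ?_⟩
      · rw [pow_succ', mul_assoc]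
        exact mul_le_mul_of_nonneg_left hab F.lam_pos.le
      · rwa [Function.iterate_succ_apply']
  choose a' b' h hab hmem using key
  rw [← F.omegaSet_iterate m]
  intro y hy
  obtain ⟨φ, hφ, hy⟩ := mem_omegaSet_iff.1 hy
  -- The left ends of the traps lie in the closed set `ω(d)` and are asymptotic to the orbit of `x`.
  have hz : Tendsto (fun n => F.toFun^[n] (F.toFun^[m] x) - a' n) atTop (𝓝 0) := by
    refine squeeze_zero_norm (fun n => ?_) (F.tendsto_lam_pow_mul ε)
    rw [Real.norm_eq_abs, abs_of_pos (sub_pos.2 (hmem n).1)]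
    linarith [(hmem n).2, hab n]
  have := hy.sub (hz.comp hφ.tendsto_atTop)
  simp only [Function.comp, sub_sub_cancel, sub_zero] at this
  exact (F.isClosed_omegaSet _).mem_of_tendsto this
    (Eventually.of_forall fun j => (h _).left_mem_omegaSet hD hd)

/-- A relation without dead ends on a finite nonempty set, transitive, has a reflexive element. -/
theorem _root_.exists_refl_of_finite_of_trans {α : Type*} {S : Set α} (hS : S.Finite)
    (r : α → α → Prop) (htrans : ∀ s ∈ S, ∀ t ∈ S, ∀ u ∈ S, r s t → r t u → r s u)
    (hne : S.Nonempty) (hr : ∀ s ∈ S, ∃ t ∈ S, r s t) : ∃ s ∈ S, r s s := by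
  -- Iterate a choice of successor until a value repeats; transitivity closes the cycle.
  choose! g hgS hg using hr
  obtain ⟨s, hs⟩ := hne
  have hmem : ∀ n, g^[n] s ∈ S := fun n => by
    induction n with
    | zero => exact hs
    | succ n ih => rw [Function.iterate_succ_apply']; exact hgS _ ih
  have hlt : ∀ m k, r (g^[m] s) (g^[m + k + 1] s) := fun m k => by
    induction k with
    | zero => rw [Function.iterate_succ_apply']; exact hg _ (hmem m)
    | succ k ih =>
      refine htrans _ (hmem _) _ (hmem _) _ (hmem _) ih ?_
      rw [← add_assoc, Function.iterate_succ_apply' g (m + k + 1)]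
      exact hg _ (hmem _)
  obtain ⟨m, -, n, -, hmn, he⟩ :=
    Set.infinite_univ.exists_lt_map_eq_of_mapsTo (f := fun n => g^[n] s) (fun n _ => hmem n) hS
  obtain ⟨k, rfl⟩ := Nat.exists_eq_add_of_lt hmn
  refine ⟨_, hmem m, ?_⟩
  have := hlt m k
  rwa [← show g^[m] s = g^[m + k + 1] s from he] at this

/-- The limit set of an orbit in `X̃` is a periodic orbit or the limit set of a recurrent one-sided
limit. -/
theorem isPeriodicOrbit_or_exists_recurrent (hinj : ∀ i < F.N, InjOn F.toFun (F.piece i))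
    (hD : F.D ⊆ F.Xtilde) {x : ℝ} (hx : x ∈ F.Xtilde) :
    F.IsPeriodicOrbit (omegaSet F.toFun x) ∨ ∃ c ∈ F.Δ, ∃ b, F.Visits x (side c b) ∧
      F.Visits (F.sideLim c b) (side c b) ∧
      omegaSet F.toFun x = omegaSet F.toFun (F.sideLim c b) := by
  have hxX := F.Xtilde_subset_X hx
  by_cases hΔ : ∀ c ∈ F.Δ, c ∉ omegaSet F.toFun x
  · exact Or.inl (F.isPeriodicOrbit_omegaSet hx hΔ)
  right
  push Not at hΔ
  obtain ⟨c₀, hc₀, hω⟩ := hΔ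
  obtain ⟨b₀, hv₀⟩ := F.exists_visits_side hx hc₀ hω
  have hlim : ∀ c ∈ F.Δ, ∀ b, F.Visits x (side c b) → F.sideLim c b ∈ F.Xtilde :=
    fun c hc b hv => hD (hv.sideLim_spec hxX hc).1
  -- The vertices are the sides visited by `x`, and `s` is related to `t` when the limit at `s` has
  -- an orbit visiting `t`.
  obtain ⟨s, hs, hr⟩ := exists_refl_of_finite_of_trans
    (S := {s : ℝ × Bool | s.1 ∈ F.Δ ∧ F.Visits x (side s.1 s.2)})
    ((F.finite_Δ.prod (Set.finite_univ (α := Bool))).subset fun s hs => ⟨hs.1, mem_univ _⟩)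
    (fun s t => F.Visits (F.sideLim s.1 s.2) (side t.1 t.2))
    (fun s hs t ht u _ hst htu => by
      have hsX := F.Xtilde_subset_X (hlim _ hs.1 _ hs.2)
      exact (F.mem_omegaSet_iff_visits.1 (hst.sideLim_mem_omegaSet hsX ht.1)).trans hsX
        (hlim _ ht.1 _ ht.2) (side_open_basis _ _) htu)
    ⟨(c₀, b₀), hc₀, hv₀⟩
    (fun s hs => by
      have hst := hlim _ hs.1 _ hs.2
      have hsx := hs.2.sideLim_mem_omegaSet hxX hs.1
      -- No dead end: otherwise the limit at `s` would lead to a periodic orbit, which would attract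
      -- `x` as well, although `ω(x)` contains the point `s.1` of `Δ`.
      have hne : ∃ c ∈ F.Δ, c ∈ omegaSet F.toFun (F.sideLim s.1 s.2) := by
        by_contra hcon
        push Not at hcon
        have hper := F.isPeriodicOrbit_omegaSet hst hcon
        obtain ⟨z, hz⟩ := hper.nonempty
        have heq := hper.omegaSet_eq_of_mem hx hz (F.omegaSet_subset_of_mem hxX hst hsx hz)
        exact hcon s.1 hs.1 (heq ▸ hs.2.mem_omegaSet)
      obtain ⟨c, hc, hcω⟩ := hne
      obtain ⟨b, hb⟩ := F.exists_visits_side hst hc hcω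
      exact ⟨(c, b), ⟨hc, (F.mem_omegaSet_iff_visits.1 hsx).trans hxX hst
        (side_open_basis _ _) hb⟩, hb⟩)
  exact ⟨s.1, hs.1, s.2, hs.2, hr, omegaSet_eq_omegaSet_sideLim hinj hD hx hs.1 hr hs.2⟩

variable (F)

theorem abs_sub_rightLim_le {c u : ℝ} (hc : c ∈ F.X) (hu : u ∈ F.X \ F.Δ) (hcu : c < u)
    (h : ∀ c' ∈ F.Δ, c' ∉ Ioo c u) :
    |F.toFun u - Function.rightLim F.toFun c| ≤ F.lam * |u - c| := by
  obtain ⟨i, hi, h1, h2⟩ := F.exists_c_le_and_le_c hc hu.1 hcu h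
  have := F.abs_rightLim_sub_leftLim_le hi h1 hcu h2
  rwa [F.leftLim_eq_of_notMem_Δ hu (hc.1.trans_lt hcu), abs_sub_comm,
    ← abs_of_pos (sub_pos.2 hcu)] at this

theorem abs_sub_leftLim_le {c u : ℝ} (hc : c ∈ F.X) (hu : u ∈ F.X \ F.Δ) (hcu : u < c)
    (h : ∀ c' ∈ F.Δ, c' ∉ Ioo u c) :
    |F.toFun u - Function.leftLim F.toFun c| ≤ F.lam * |u - c| := by
  obtain ⟨i, hi, h1, h2⟩ := F.exists_c_le_and_le_c hu.1 hc hcu h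
  have := F.abs_rightLim_sub_leftLim_le hi h1 hcu h2
  rwa [F.rightLim_eq_of_notMem_Δ hu (hcu.trans_le hc.2), ← abs_of_pos (sub_pos.2 hcu),
    abs_sub_comm c u] at this

/-! ### Recurrent one-sided limits -/

/-- The orbit of the one-sided limit of the map at a point of `Δ` accumulates at that point from
the same side. -/
structure IsRecurrentSide (c : ℝ) (b : Bool) : Prop where
  mem_Δ : c ∈ F.Δ
  mem_D : F.sideLim c b ∈ F.D
  visits : F.Visits (F.sideLim c b) (side c b)

namespace IsRecurrentSide

variable {F} {c : ℝ} {b : Bool} (h : F.IsRecurrentSide c b)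
  (hinj : ∀ i < F.N, InjOn F.toFun (F.piece i)) (hD : F.D ⊆ F.Xtilde)
include h hD

theorem mem_X : F.sideLim c b ∈ F.X := F.Xtilde_subset_X (hD h.mem_D)

theorem mem_omegaSet : F.sideLim c b ∈ omegaSet F.toFun (F.sideLim c b) :=
  h.visits.sideLim_mem_omegaSet (h.mem_X hD) h.mem_Δ

theorem orbit_subset : orbit F.toFun (F.sideLim c b) ⊆ omegaSet F.toFun (F.sideLim c b) :=
  F.orbit_subset_omegaSet (h.mem_X hD) (hD h.mem_D) (h.mem_omegaSet hD)

/-- If `ω(d)` were finite, the orbit of `d` would be finite, hence closed, and would contain `c ∈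
Δ`; but this orbit lies in `X̃`. -/
theorem infinite_omegaSet : (omegaSet F.toFun (F.sideLim c b)).Infinite := fun hfin => by
  have h1 := F.omegaSet_subset_closure_orbit _ h.visits.mem_omegaSet
  rw [(hfin.subset (h.orbit_subset hD)).isClosed.closure_eq] at h1
  exact F.Xtilde_disjoint_Δ (F.orbit_subset_Xtilde (hD h.mem_D) h1) h.mem_Δ

theorem sideLim_spec_of_visits {c' : ℝ} {b' : Bool} (hc' : c' ∈ F.Δ)
    (hv : F.Visits (F.sideLim c b) (side c' b')) : F.sideLim c' b' ∈ F.Xtilde ∧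
    F.sideLim c' b' ∈ omegaSet F.toFun (F.sideLim c b) :=
  ⟨hD (hv.sideLim_spec (h.mem_X hD) hc').1, hv.sideLim_mem_omegaSet (h.mem_X hD) hc'⟩

-- Either `ω(x)` is periodic and attracts `d`, or it comes from a recurrent side that `d` visits
-- too. In both cases `d` is caught by the limit set of `x`.
include hinj in
theorem omegaSet_eq {x : ℝ} (hx : x ∈ F.Xtilde) (hxK : x ∈ omegaSet F.toFun (F.sideLim c b)) :
    omegaSet F.toFun (F.sideLim c b) = omegaSet F.toFun x := by
  have hdt := hD h.mem_D
  rcases isPeriodicOrbit_or_exists_recurrent hinj hD hx with hp | ⟨c', hc', b', hv, hr, he⟩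
  · obtain ⟨z, hz⟩ := hp.nonempty
    exact hp.omegaSet_eq_of_mem hdt hz (F.omegaSet_subset_of_mem (h.mem_X hD) hx hxK hz)
  · rw [he]
    exact omegaSet_eq_omegaSet_sideLim hinj hD hdt hc' hr
      ((F.mem_omegaSet_iff_visits.1 hxK).trans (h.mem_X hD) hx (side_open_basis _ _) hv)

include hinj in
theorem closure_orbit_eq {x : ℝ} (hx : x ∈ F.Xtilde)
    (hxK : x ∈ omegaSet F.toFun (F.sideLim c b)) :
    closure (orbit F.toFun x) = omegaSet F.toFun (F.sideLim c b) :=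
  F.closure_orbit_eq_omegaSet (h.mem_X hD) hx hxK (h.omegaSet_eq hinj hD hx hxK)

include hinj in
theorem isXtildeMinimal : F.IsXtildeMinimal (omegaSet F.toFun (F.sideLim c b)) :=
  ⟨F.omegaSet_subset_X (h.mem_X hD), fun _ hx => h.closure_orbit_eq hinj hD hx.2 hx.1⟩

theorem isPseudoInvariant : F.IsPseudoInvariant (omegaSet F.toFun (F.sideLim c b)) := by
  have hX := h.mem_X hD
  refine ⟨F.omegaSet_subset_X hX, fun y hy => ?_⟩
  have hyX := F.omegaSet_subset_X hX hy
  by_cases hyΔ : y ∈ F.Δ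
  · obtain ⟨b', hb'⟩ := F.exists_visits_side (hD h.mem_D) hyΔ hy
    refine ⟨_, hb'.sideLim_mem_omegaSet hX hyΔ, ?_⟩
    have ht := (hb'.sideLim_spec hX hyΔ).2
    cases b'
    · obtain ⟨n, hn⟩ := (hb' (Iio y) self_mem_nhdsWithin).exists
      exact Or.inl ⟨(F.iterate_mem_X hX n).1.trans_lt hn, ht⟩
    · obtain ⟨n, hn⟩ := (hb' (Ioi y) self_mem_nhdsWithin).exists
      exact Or.inr ⟨lt_of_lt_of_le hn (F.iterate_mem_X hX n).2, ht⟩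
  · refine ⟨_, F.apply_mem_omegaSet hX hyΔ hy, ?_⟩
    rcases hyX.1.lt_or_eq with h0 | h0
    · exact Or.inl ⟨h0, F.tendsto_nhdsLT_of_notMem_Δ ⟨hyX, hyΔ⟩ h0⟩
    · have : y < F.c F.N := h0 ▸ F.c_zero_lt_c_N
      exact Or.inr ⟨this, F.tendsto_nhdsGT_of_notMem_Δ ⟨hyX, hyΔ⟩ this⟩

/-- A repetition would make the orbit eventually periodic and its limit set finite. -/
theorem injective_iterate : Function.Injective fun n => F.toFun^[n] (F.sideLim c b) := by
  have key : ∀ m k, F.toFun^[m] (F.sideLim c b) ≠ F.toFun^[m + k + 1] (F.sideLim c b) := by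
    intro m k he
    have hper : F.IsPeriodicOrbit (orbit F.toFun (F.toFun^[m] (F.sideLim c b))) := by
      refine ⟨F.orbit_subset_Xtilde (F.iterate_mem_Xtilde (hD h.mem_D) m), _,
        ⟨k + 1, Nat.succ_pos k, ?_⟩, rfl⟩
      rw [Function.IsPeriodicPt, Function.IsFixedPt, ← Function.iterate_add_apply,
        show k + 1 + m = m + k + 1 by omega]
      exact he.symm
    refine h.infinite_omegaSet hD ?_
    rw [← F.omegaSet_iterate m, hper.omegaSet_eq (z := F.toFun^[m] (F.sideLim c b)) ⟨0, rfl⟩]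
    exact hper.finite
  intro m n he
  rcases lt_trichotomy m n with h1 | h1 | h1
  · obtain ⟨k, rfl⟩ := Nat.exists_eq_add_of_lt h1
    exact absurd he (key m k)
  · exact h1
  · obtain ⟨k, rfl⟩ := Nat.exists_eq_add_of_lt h1
    exact absurd he.symm (key n k)

theorem perfect : Perfect (omegaSet F.toFun (F.sideLim c b)) := by
  refine ⟨F.isClosed_omegaSet _, fun y hy => ?_⟩
  rw [accPt_iff_nhds]
  intro U hU
  have hfr := F.mem_omegaSet_iff_visits.1 hy U hU
  obtain ⟨m, -, hm⟩ := frequently_atTop.1 hfr 0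
  obtain ⟨n, hmn, hn⟩ := frequently_atTop.1 hfr (m + 1)
  by_cases he : F.toFun^[m] (F.sideLim c b) = y
  · refine ⟨_, ⟨hn, h.orbit_subset hD ⟨n, rfl⟩⟩, fun he' => ?_⟩
    have := h.injective_iterate hD (he.trans he'.symm)
    omega
  · exact ⟨_, ⟨hm, h.orbit_subset hD ⟨m, rfl⟩⟩, he⟩

end IsRecurrentSide

/-! ### Limit sets are null sets -/

/-- Along an ultrafilter of times with `f^(n+1)(d) → y`, the preceding points converge by
compactness to some `y'`. If `y' ∈ Δ`, the ultrafilter selects a side and `y` is a one-sided limit;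
otherwise continuity gives `f y' = y`. -/
theorem mem_D_or_exists_apply_eq {d y : ℝ} (hd : d ∈ F.Xtilde) (hy : y ∈ omegaSet F.toFun d) :
    y ∈ F.D ∨ ∃ y' ∈ F.X \ F.Δ, y' ∈ omegaSet F.toFun d ∧ F.toFun y' = y := by
  have hX := F.Xtilde_subset_X hd
  rw [← F.omegaSet_iterate 1, omegaSet, mem_omegaLimit_singleton_iff_mapClusterPt,
    mapClusterPt_iff_ultrafilter] at hy
  obtain ⟨V, hV, hyV⟩ := hy
  have hyV' : Tendsto (fun n => F.toFun (F.toFun^[n] d)) V (𝓝 y) :=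
    hyV.congr fun n => by
      rw [← Function.iterate_add_apply, Function.iterate_succ_apply']
  obtain ⟨y', hy'X, hy'⟩ := F.isCompact_X.ultrafilter_le_nhds (V.map fun n => F.toFun^[n] d)
    (by
      rw [le_principal_iff]
      exact Eventually.of_forall (f := (V : Filter ℕ)) fun n => F.iterate_mem_X hX n)
  have hvis : ∀ G : Filter ℝ, Tendsto (fun n => F.toFun^[n] d) V G → F.Visits d G :=
    fun G hG U hU => (Eventually.frequently (f := (V : Filter ℕ)) (hG hU)).filter_mono hV
  have hy'ω : y' ∈ omegaSet F.toFun d := F.mem_omegaSet_iff_visits.2 (hvis _ hy')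
  by_cases hΔ : y' ∈ F.Δ
  · left
    have key : ∀ b, Tendsto (fun n => F.toFun^[n] d) V (side y' b) → y ∈ F.D := fun b hb => by
      have := (hvis _ hb).sideLim_spec hX hΔ
      rw [tendsto_nhds_unique hyV' (this.2.comp hb)]
      exact this.1
    have hne : ∀ n, F.toFun^[n] d ≠ y' := fun n e => (hd n).2 (e ▸ hΔ)
    rcases V.eventually_or.1 (Eventually.of_forall fun n => lt_or_gt_of_ne (hne n)) with h | h
    · exact key false (tendsto_nhdsWithin_iff.2 ⟨hy', h⟩)
    · exact key true (tendsto_nhdsWithin_iff.2 ⟨hy', h⟩)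
  · refine Or.inr ⟨y', ⟨hy'X, hΔ⟩, hy'ω, ?_⟩
    refine tendsto_nhds_unique
      ((F.continuousWithinAt_of_notMem_Δ ⟨hy'X, hΔ⟩).tendsto.comp ?_) hyV'
    exact tendsto_nhdsWithin_iff.2 ⟨hy', Eventually.of_forall fun n => F.iterate_mem_X hX n⟩

theorem finite_D : F.D.Finite := by
  refine (((Set.finite_Iic F.N).image F.dMinus).union
    ((Set.finite_Iic F.N).image F.dPlus)).subset ?_
  rintro y (⟨k, -, hk, rfl⟩ | ⟨k, hk, rfl⟩)
  · exact Or.inl ⟨k, hk, rfl⟩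
  · exact Or.inr ⟨k, hk.le, rfl⟩

-- Up to a finite set, `ω(d)` is covered by the images of its disjoint parts inside the pieces, so
-- its measure is at most `lam < 1` times itself.
open MeasureTheory Measure in
theorem volume_omegaSet {d : ℝ} (hd : d ∈ F.Xtilde) : volume (omegaSet F.toFun d) = 0 := by
  set K := omegaSet F.toFun d with hK
  set T := F.D ∪ F.toFun '' (F.c '' Iic F.N) with hT
  set J : ℕ → Set ℝ := fun i => K ∩ Ioo (F.c i) (F.c (i + 1)) with hJ
  have hTfin : T.Finite := F.finite_D.union (((Set.finite_Iic _).image _).image _)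
  have hcover : K ⊆ T ∪ ⋃ i ∈ Finset.range F.N, F.toFun '' J i := by
    intro y hy
    rcases F.mem_D_or_exists_apply_eq hd hy with h | ⟨y', hy', hyω, rfl⟩
    · exact Or.inl (Or.inl h)
    · obtain ⟨i, hi, h⟩ := F.exists_mem_Icc_c hy'.1
      rcases h.1.eq_or_lt with h1 | h1
      · exact Or.inl (Or.inr ⟨y', ⟨i, hi.le, h1⟩, rfl⟩)
      rcases h.2.eq_or_lt with h2 | h2
      · exact Or.inl (Or.inr ⟨y', ⟨i + 1, hi, h2.symm⟩, rfl⟩)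
      exact Or.inr (mem_biUnion (Finset.mem_coe.2 (Finset.mem_range.2 hi))
        ⟨y', ⟨hyω, h1, h2⟩, rfl⟩)
  have himg : ∀ i ∈ Finset.range F.N,
      volume (F.toFun '' J i) ≤ ENNReal.ofReal F.lam * volume (J i) := fun i hi => by
    have hL : LipschitzOnWith ⟨F.lam, F.lam_pos.le⟩ F.toFun (J i) :=
      LipschitzOnWith.of_dist_le_mul fun x hx y hy => by
        rw [Real.dist_eq, Real.dist_eq]
        have hi := Finset.mem_range.1 hi
        exact F.abs_sub_le_of_mem_piece hi (F.Ioo_subset_piece hi hx.2)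
          (F.Ioo_subset_piece hi hy.2)
    have := hL.hausdorffMeasure_image_le zero_le_one
    rw [hausdorffMeasure_real, ENNReal.rpow_one] at this
    refine this.trans_eq ?_
    congr 1
    exact (ENNReal.ofReal_eq_coe_nnreal F.lam_pos.le).symm
  have hdisj : (Finset.range F.N : Set ℕ).PairwiseDisjoint J := by
    have key : ∀ i j, i < j → j < F.N → Disjoint (J i) (J j) := fun i j hij hj => by
      rw [Set.disjoint_left]
      intro x hx hx'
      exact absurd ((hx.2.2.trans_le (F.c_le_c hij hj.le)).trans hx'.2.1) (lt_irrefl _)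
    intro i hi j hj hij
    rcases lt_or_gt_of_ne hij with h | h
    · exact key i j h (by simpa using hj)
    · exact (key j i h (by simpa using hi)).symm
  have hKcl : IsClosed K := F.isClosed_omegaSet d
  have hsum : ∑ i ∈ Finset.range F.N, volume (J i) ≤ volume K := by
    rw [← measure_biUnion_finset hdisj fun i _ => hKcl.measurableSet.inter measurableSet_Ioo]
    exact measure_mono (iUnion₂_subset fun i _ => inter_subset_left)
  have hle : volume K ≤ ENNReal.ofReal F.lam * volume K := calc
    volume K ≤ volume T + volume (⋃ i ∈ Finset.range F.N, F.toFun '' J i) :=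
      (measure_mono hcover).trans (measure_union_le _ _)
    _ = volume (⋃ i ∈ Finset.range F.N, F.toFun '' J i) := by
      rw [hTfin.measure_zero volume, zero_add]
    _ ≤ ∑ i ∈ Finset.range F.N, volume (F.toFun '' J i) := measure_biUnion_finset_le _ _
    _ ≤ ∑ i ∈ Finset.range F.N, ENNReal.ofReal F.lam * volume (J i) := Finset.sum_le_sum himg
    _ ≤ ENNReal.ofReal F.lam * volume K := by
      rw [← Finset.mul_sum]
      gcongr
  by_contra hne
  have hfin : volume K ≠ ⊤ :=
    ((F.isCompact_X.of_isClosed_subset hKcl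
      (F.omegaSet_subset_X (F.Xtilde_subset_X hd))).measure_lt_top).ne
  refine absurd hle (not_le.2 ?_)
  calc ENNReal.ofReal F.lam * volume K < 1 * volume K :=
        ENNReal.mul_lt_mul_left hne hfin (by
          rw [ENNReal.ofReal_lt_one]; exact F.lam_lt_one)
    _ = volume K := one_mul _

theorem _root_.isTotallyDisconnected_of_volume_eq_zero {K : Set ℝ}
    (h : MeasureTheory.volume K = 0) : IsTotallyDisconnected K := by
  intro t ht hpc x hx y hy
  have key : ∀ x ∈ t, ∀ y ∈ t, ¬ x < y := fun x hx y hy hxy => by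
    have h1 := MeasureTheory.measure_mono_null ((hpc.ordConnected.out hx hy).trans ht) h
    rw [Real.volume_Icc, ENNReal.ofReal_eq_zero] at h1
    linarith
  exact le_antisymm (not_lt.1 (key y hy x hx)) (not_lt.1 (key x hx y hy))

variable {F} in
theorem IsRecurrentSide.isCantorSet {c : ℝ} {b : Bool} (h : F.IsRecurrentSide c b)
    (hD : F.D ⊆ F.Xtilde) : IsCantorSet (omegaSet F.toFun (F.sideLim c b)) where
  nonempty := ⟨_, h.mem_omegaSet hD⟩
  isCompact := F.isCompact_X.of_isClosed_subset (F.isClosed_omegaSet _)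
    (F.omegaSet_subset_X (h.mem_X hD))
  perfect := h.perfect hD
  isTotallyDisconnected := isTotallyDisconnected_of_volume_eq_zero (F.volume_omegaSet (hD h.mem_D))

/-! ### Points of `Δ` in a Cantor limit set -/

variable {F} in
theorem IsRecurrentSide.exists_visits_both {c : ℝ} {b : Bool} (h : F.IsRecurrentSide c b)
    (hD : F.D ⊆ F.Xtilde) : ∃ c' ∈ F.Δ, F.Visits (F.sideLim c b) (side c' true) ∧
      F.Visits (F.sideLim c b) (side c' false) := by
  by_contra hcon
  push Not at hcon
  have hX := h.mem_X hD
  have hdt := hD h.mem_D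
  obtain ⟨ε, hε, hsep, hscale⟩ := F.exists_scale (F.sideLim c b)
  have horb : ∀ n, F.toFun^[n] (F.sideLim c b) ∈ omegaSet F.toFun (F.sideLim c b) :=
    fun n => h.orbit_subset hD ⟨n, rfl⟩
  have hcX := F.Δ_subset_X h.mem_Δ
  -- `d` is the limit of `f` on the side of `c` that its orbit visits: an iterate close to `c` there
  -- is mapped even closer to `d`.
  obtain ⟨n, hn⟩ : ∃ n, |F.toFun^[n + 1] (F.sideLim c b) - F.sideLim c b| < ε := by
    suffices hs : ∃ n, |F.toFun^[n + 1] (F.sideLim c b) - F.sideLim c b| ≤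
        F.lam * |F.toFun^[n] (F.sideLim c b) - c| ∧ |F.toFun^[n] (F.sideLim c b) - c| < ε by
      obtain ⟨n, h1, h2⟩ := hs
      refine ⟨n, h1.trans_lt (lt_of_le_of_lt ?_ h2)⟩
      exact mul_le_of_le_one_left (abs_nonneg _) F.lam_lt_one.le
    have hv := h.visits
    cases b
    · obtain ⟨n, hn⟩ := (hv _ (Ioo_mem_nhdsLT (sub_lt_self c hε))).exists
      refine ⟨n, ?_, by rw [abs_lt]; constructor <;> linarith [hn.1, hn.2]⟩
      rw [Function.iterate_succ_apply']
      refine F.abs_sub_leftLim_le hcX (hdt n) hn.2 fun c' hc' h' => ?_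
      refine h'.2.ne' (hsep c h.mem_Δ c' hc' (abs_lt.2 ⟨?_, ?_⟩)) <;> linarith [h'.1, h'.2, hn.1]
    · obtain ⟨n, hn⟩ := (hv _ (Ioo_mem_nhdsGT (lt_add_of_pos_right c hε))).exists
      refine ⟨n, ?_, by rw [abs_lt]; constructor <;> linarith [hn.1, hn.2]⟩
      rw [Function.iterate_succ_apply']
      refine F.abs_sub_rightLim_le hcX (hdt n) hn.1 fun c' hc' h' => ?_
      refine h'.1.ne (hsep c h.mem_Δ c' hc' (abs_lt.2 ⟨?_, ?_⟩)) <;> linarith [h'.1, h'.2, hn.2]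
  have hinf := h.infinite_omegaSet hD
  generalize F.sideLim c b = d at *
  -- Two points of `ω(d)` within `ε` and separated by `c'` would show that the orbit visits both
  -- sides of `c'`, which is excluded. So the close return found above is never separated.
  have hns : ∀ u ∈ omegaSet F.toFun d, ∀ v ∈ omegaSet F.toFun d, u ∉ F.Δ → v ∉ F.Δ →
      |u - v| < ε → F.NotSep u v := by
    have key : ∀ u ∈ omegaSet F.toFun d, ∀ v ∈ omegaSet F.toFun d, v ∉ F.Δ →
        |u - v| < ε → ∀ c' ∈ F.Δ, u < c' → v < c' := by
      intro u hu v hv hvΔ huv c' hc' h1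
      by_contra h2
      have h3 : c' < v := lt_of_le_of_ne (not_lt.1 h2) fun e => hvΔ (e ▸ hc')
      rw [abs_lt] at huv
      exact hcon c' hc' ((hscale c' hc' v hv).1 ⟨h3, by linarith⟩)
        ((hscale c' hc' u hu).2 ⟨by linarith, h1⟩)
    intro u hu v hv huΔ hvΔ huv c' hc'
    exact ⟨key u hu v hv hvΔ huv c' hc', key v hv u hu huΔ (abs_sub_comm u v ▸ huv) c' hc'⟩
  have hlt : ∀ j, |F.toFun^[j + (n + 1)] d - F.toFun^[j] d| < ε := fun j => by
    induction j with
    | zero => simpa using hn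
    | succ j ih =>
      rw [Nat.add_right_comm, Function.iterate_succ_apply', Function.iterate_succ_apply' F.toFun j]
      refine ((F.abs_sub_le_of_notSep (hdt _) (hdt _)
        (hns _ (horb _) _ (horb _) (hdt _).2 (hdt _).2 ih)).trans ?_).trans_lt ih
      exact mul_le_of_le_one_left (abs_nonneg _) F.lam_lt_one.le
  obtain ⟨z, -, -, hfin, hω⟩ := F.exists_tendsto_of_notSep hdt (Nat.le_add_left 1 n)
    fun j => hns _ (horb _) _ (horb _) (hdt _).2 (hdt _).2 (hlt j)
  exact hinf (hω ▸ hfin)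

theorem exists_interior_index {x c : ℝ} (hx : x ∈ F.X) (hc : c ∈ F.Δ)
    (h1 : F.Visits x (side c true)) (h2 : F.Visits x (side c false)) :
    ∃ k, 1 ≤ k ∧ k < F.N ∧ c = F.c k := by
  obtain ⟨k, hk, rfl⟩ := F.exists_eq_c_of_mem_Δ hc
  obtain ⟨n, hn⟩ := (h1 (Ioi (F.c k)) self_mem_nhdsWithin).exists
  obtain ⟨m, hm⟩ := (h2 (Iio (F.c k)) self_mem_nhdsWithin).exists
  refine ⟨k, Nat.one_le_iff_ne_zero.2 ?_, lt_of_le_of_ne hk ?_, rfl⟩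
  · rintro rfl
    exact absurd hm (not_lt.2 (F.iterate_mem_X hx m).1)
  · rintro rfl
    exact absurd hn (not_lt.2 (F.iterate_mem_X hx n).2)

theorem _root_.isGapBoundaryPoint_of_Ioo {X K : Set ℝ} {a b c : ℝ} (hab : a < b)
    (h : Ioo a b ⊆ X \ K) (hc : c ∈ K) (hcab : c ∈ Icc a b) : IsGapBoundaryPoint X K c := by
  obtain ⟨y, hy⟩ := exists_between hab
  refine ⟨y, h hy, ?_, fun hi => ?_⟩
  · have := closure_mono (isPreconnected_Ioo.subset_connectedComponentIn hy h)
    rw [closure_Ioo hab.ne] at this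
    exact this hcab
  · exact (connectedComponentIn_subset _ _ (interior_subset hi)).2 hc

/-- A side that is not visited contains an interval adjacent to `c` and disjoint from `ω(x)`, hence
part of a gap. -/
theorem visits_side_or_isGapBoundaryPoint {x c : ℝ} (hc : c ∈ Ioo (F.c 0) (F.c F.N))
    (hcω : c ∈ omegaSet F.toFun x) (b : Bool) :
    F.Visits x (side c b) ∨ IsGapBoundaryPoint F.X (omegaSet F.toFun x) c := by
  refine or_iff_not_imp_left.2 fun hv => ?_
  simp only [Visits, not_forall] at hv
  obtain ⟨U, hU, hn⟩ := hv
  have hdis : ∀ p q, Ioo p q ⊆ U → Ioo p q ∩ omegaSet F.toFun x = ∅ := fun p q hpq => by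
    rw [eq_empty_iff_forall_notMem]
    rintro y ⟨h1, h2⟩
    exact hn ((F.visits_of_mem_omegaSet h2 isOpen_Ioo h1).mono fun n hn => hpq hn)
  cases b
  · obtain ⟨l, hl, hlU⟩ := (mem_nhdsLT_iff_exists_mem_Ico_Ioo_subset hc.1).1 hU
    refine isGapBoundaryPoint_of_Ioo hl.2 (fun y hy => ⟨?_, fun hyω => ?_⟩) hcω ⟨hl.2.le, le_rfl⟩
    · exact ⟨hl.1.trans hy.1.le, hy.2.le.trans hc.2.le⟩
    · exact (hdis _ _ hlU).le ⟨hy, hyω⟩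
  · obtain ⟨l, hl, hlU⟩ := (mem_nhdsGT_iff_exists_mem_Ioc_Ioo_subset hc.2).1 hU
    refine isGapBoundaryPoint_of_Ioo hl.1 (fun y hy => ⟨?_, fun hyω => ?_⟩) hcω ⟨le_rfl, hl.1.le⟩
    · exact ⟨hc.1.le.trans hy.1.le, hy.2.le.trans hl.2⟩
    · exact (hdis _ _ hlU).le ⟨hy, hyω⟩

/-! ### The attractor -/

/-- The union of the orbits of the one-sided limits. -/
def orbitsD : Set ℝ := {p | ∃ d ∈ F.D, p ∈ orbit F.toFun d}

variable {F}

theorem orbitsD_subset_Xtilde (hD : F.D ⊆ F.Xtilde) : F.orbitsD ⊆ F.Xtilde := by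
  rintro p ⟨d, hd, h⟩
  exact F.orbit_subset_Xtilde (hD hd) h

theorem apply_mem_orbitsD {p : ℝ} (hp : p ∈ F.orbitsD) : F.toFun p ∈ F.orbitsD := by
  obtain ⟨d, hd, n, rfl⟩ := hp
  exact ⟨d, hd, n + 1, Function.iterate_succ_apply' _ _ _⟩

/-- The point `max a (F.c i)` is the left end of an interval starting at `a` after clipping to piece
`i`. It is either a partition point, whose one-sided limit is in `D`, or a point of `X̃`, where the
limit is the value of `f`. -/
theorem rightLim_mem_orbitsD (hD : F.D ⊆ F.Xtilde) {i : ℕ} (hi : i < F.N) {a : ℝ}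
    (ha : a ∈ F.orbitsD ∪ F.c '' Iic F.N) (hai : a < F.c (i + 1)) :
    Function.rightLim F.toFun (max a (F.c i)) ∈ F.orbitsD := by
  rcases le_or_gt a (F.c i) with h | h
  · rw [max_eq_right h]
    exact ⟨_, Or.inr ⟨i, hi, rfl⟩, 0, rfl⟩
  · rw [max_eq_left h.le]
    rcases ha with ha | ⟨k, hk, rfl⟩
    · rw [F.rightLim_eq_of_notMem_Δ (a := a) (orbitsD_subset_Xtilde hD ha 0)
        (hai.trans_le (F.c_le_c hi le_rfl))]
      exact apply_mem_orbitsD ha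
    · exfalso
      rcases le_or_gt k i with h1 | h1
      · exact h.not_ge (F.c_le_c h1 hi.le)
      · exact hai.not_ge (F.c_le_c h1 hk)

theorem leftLim_mem_orbitsD (hD : F.D ⊆ F.Xtilde) {i : ℕ} (hi : i < F.N) {b : ℝ}
    (hb : b ∈ F.orbitsD ∪ F.c '' Iic F.N) (hbi : F.c i < b) :
    Function.leftLim F.toFun (min b (F.c (i + 1))) ∈ F.orbitsD := by
  rcases le_or_gt (F.c (i + 1)) b with h | h
  · rw [min_eq_right h]
    exact ⟨_, Or.inl ⟨i + 1, Nat.le_add_left 1 i, hi, rfl⟩, 0, rfl⟩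
  · rw [min_eq_left h.le]
    rcases hb with hb | ⟨k, hk, rfl⟩
    · rw [F.leftLim_eq_of_notMem_Δ (a := b) (orbitsD_subset_Xtilde hD hb 0)
        ((F.c_le_c (Nat.zero_le i) hi.le).trans_lt hbi)]
      exact apply_mem_orbitsD hb
    · exfalso
      rcases le_or_gt k i with h1 | h1
      · exact hbi.not_ge (F.c_le_c h1 hi.le)
      · exact h.not_ge (F.c_le_c h1 hk)

/-- `S` is a finite family of nondegenerate intervals of length at most `M` with end points in `Q`
that covers `A`. -/
structure IsIntervalCover (Q A : Set ℝ) (M : ℝ) (S : Set (ℝ × ℝ)) : Prop where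
  finite : S.Finite
  lt : ∀ p ∈ S, p.1 < p.2
  left : ∀ p ∈ S, p.1 ∈ Q
  right : ∀ p ∈ S, p.2 ∈ Q
  length_le : ∀ p ∈ S, p.2 - p.1 ≤ M
  cover : ∀ y ∈ A, ∃ p ∈ S, y ∈ Icc p.1 p.2

/-- Clip each interval to each piece and replace the clipped ends by their one-sided limits.
Partition points are allowed as ends before the step, to start from `X`; afterwards all ends lie on
orbits of `D`. -/
theorem IsIntervalCover.image (hinj : ∀ i < F.N, InjOn F.toFun (F.piece i))
    (hD : F.D ⊆ F.Xtilde) {A : Set ℝ} {M : ℝ} {S : Set (ℝ × ℝ)}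
    (h : IsIntervalCover (F.orbitsD ∪ F.c '' Iic F.N) A M S) (hA : A ⊆ F.X) :
    ∃ S', IsIntervalCover F.orbitsD (closure (F.toFun '' (A \ F.Δ))) (F.lam * M) S' := by
  set Q := F.orbitsD ∪ F.c '' Iic F.N with hQ
  have hQX : Q ⊆ F.X := by
    rintro y (hy | ⟨k, hk, rfl⟩)
    · exact F.Xtilde_subset_X (orbitsD_subset_Xtilde hD hy)
    · exact F.c_mem_X hk
  set lo : (ℝ × ℝ) × ℕ → ℝ := fun q => max q.1.1 (F.c q.2) with hlo
  set hi' : (ℝ × ℝ) × ℕ → ℝ := fun q => min q.1.2 (F.c (q.2 + 1)) with hhi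
  set g : (ℝ × ℝ) × ℕ → ℝ × ℝ := fun q =>
    (min (Function.rightLim F.toFun (lo q)) (Function.leftLim F.toFun (hi' q)),
      max (Function.rightLim F.toFun (lo q)) (Function.leftLim F.toFun (hi' q))) with hg
  set T : Set ((ℝ × ℝ) × ℕ) := {q | q.1 ∈ S ∧ q.2 < F.N ∧ lo q < hi' q} with hT
  have hTfin : T.Finite :=
    (h.finite.prod (Set.finite_Iio F.N)).subset fun q hq => ⟨hq.1, hq.2.1⟩
  have hr : ∀ q ∈ T, Function.rightLim F.toFun (lo q) ∈ F.orbitsD := fun q hq =>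
    rightLim_mem_orbitsD hD hq.2.1 (h.left _ hq.1)
      (((le_max_left _ _).trans_lt hq.2.2).trans_le (min_le_right _ _))
  have hl : ∀ q ∈ T, Function.leftLim F.toFun (hi' q) ∈ F.orbitsD := fun q hq =>
    leftLim_mem_orbitsD hD hq.2.1 (h.right _ hq.1)
      (((le_max_right _ _).trans_lt hq.2.2).trans_le (min_le_left _ _))
  have hcover : F.toFun '' (A \ F.Δ) ⊆ ⋃ q ∈ T, Icc (g q).1 (g q).2 := by
    rintro _ ⟨y, ⟨hyA, hyΔ⟩, rfl⟩
    obtain ⟨p, hp, hyp⟩ := h.cover y hyA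
    obtain ⟨i, hi, hyi⟩ := F.exists_mem_piece ⟨hA hyA, hyΔ⟩
    have h1 : lo (p, i) ≤ y := max_le hyp.1 hyi.1.1
    have h2 : y ≤ hi' (p, i) := le_min hyp.2 hyi.1.2
    -- A degenerate overlap would make `y` an end of its piece: an interior one lies in `Δ`, and at
    -- an end of `X` the interval `p` itself would have to be degenerate.
    have hlt : lo (p, i) < hi' (p, i) := by
      refine max_lt (lt_min (h.lt p hp) (lt_of_not_ge fun h3 => ?_))
        (lt_min (lt_of_not_ge fun h3 => ?_) (F.c_lt i hi))
      · have hy : y = F.c (i + 1) := le_antisymm hyi.1.2 (h3.trans hyp.1)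
        rcases (Nat.succ_le_of_lt hi).lt_or_eq with h0 | h0
        · exact hyΔ (hy ▸ F.c_mem_Δ (Nat.le_add_left 1 i) h0)
        · have := (hQX (h.right p hp)).2
          rw [← show i + 1 = F.N from h0] at this
          exact absurd (h.lt p hp) (not_lt.2 (this.trans h3))
      · have hy : y = F.c i := le_antisymm (hyp.2.trans h3) hyi.1.1
        rcases Nat.eq_zero_or_pos i with rfl | h0
        · exact absurd (h.lt p hp) (not_lt.2 (h3.trans (hQX (h.left p hp)).1))
        · exact hyΔ (hy ▸ F.c_mem_Δ h0 hi)
    exact mem_biUnion (show (p, i) ∈ T from ⟨hp, hi, hlt⟩)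
      (F.mem_uIcc_rightLim_leftLim hi (le_max_right _ _) hlt (min_le_right _ _) (hinj i hi)
        ⟨h1, h2⟩ hyΔ)
  refine ⟨g '' T, hTfin.image g, ?_, ?_, ?_, ?_, ?_⟩
  · rintro _ ⟨q, hq, rfl⟩
    exact min_lt_max.2 (F.rightLim_ne_leftLim hq.2.1 (le_max_right _ _) hq.2.2 (min_le_right _ _)
      (hinj _ hq.2.1))
  · rintro _ ⟨q, hq, rfl⟩
    exact min_rec' (· ∈ F.orbitsD) (hr q hq) (hl q hq)
  · rintro _ ⟨q, hq, rfl⟩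
    exact max_rec' (· ∈ F.orbitsD) (hr q hq) (hl q hq)
  · rintro _ ⟨q, hq, rfl⟩
    have := F.abs_rightLim_sub_leftLim_le hq.2.1 (le_max_right _ _) hq.2.2 (min_le_right _ _)
    rw [abs_sub_comm, ← max_sub_min_eq_abs] at this
    refine le_trans this ?_
    refine mul_le_mul_of_nonneg_left (le_trans ?_ (h.length_le _ hq.1)) F.lam_pos.le
    exact sub_le_sub (min_le_left _ _) (le_max_left _ _)
  · intro y hy
    have hcl : IsClosed (⋃ q ∈ T, Icc (g q).1 (g q).2) :=
      hTfin.isClosed_biUnion fun _ _ => isClosed_Icc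
    obtain ⟨q, hq, h'⟩ := mem_iUnion₂.1 (closure_minimal hcover hcl hy)
    exact ⟨g q, ⟨q, hq, rfl⟩, h'⟩

theorem lambdaSeq_subset_X (F : PCIM) (n : ℕ) : F.lambdaSeq n ⊆ F.X := by
  have key : ∀ A ⊆ F.X, closure (F.toFun '' (A \ F.Δ)) ⊆ F.X := fun A hA =>
    closure_minimal (by rintro _ ⟨y, hy, rfl⟩; exact F.mapsTo (hA hy.1)) F.isClosed_X
  induction n with
  | zero => exact key _ Subset.rfl
  | succ n ih => exact key _ ih

theorem exists_isIntervalCover_lambdaSeq (hinj : ∀ i < F.N, InjOn F.toFun (F.piece i))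
    (hD : F.D ⊆ F.Xtilde) (n : ℕ) :
    ∃ S, IsIntervalCover F.orbitsD (F.lambdaSeq n) (F.lam ^ (n + 1) * (F.c F.N - F.c 0)) S := by
  induction n with
  | zero =>
    rw [zero_add, pow_one]
    refine IsIntervalCover.image hinj hD (A := F.X) (S := {(F.c 0, F.c F.N)}) ?_ Subset.rfl
    refine ⟨finite_singleton _, ?_, ?_, ?_, ?_, fun y hy => ⟨_, rfl, hy⟩⟩ <;> rintro p rfl
    · exact F.c_zero_lt_c_N
    · exact Or.inr ⟨0, Nat.zero_le _, rfl⟩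
    · exact Or.inr ⟨F.N, mem_Iic.2 le_rfl, rfl⟩
    · exact le_rfl
  | succ n ih =>
    obtain ⟨S, hS⟩ := ih
    rw [pow_succ', mul_assoc]
    exact IsIntervalCover.image hinj hD (S := S) ⟨hS.finite, hS.lt, fun p hp => Or.inl (hS.left p hp),
      fun p hp => Or.inl (hS.right p hp), hS.length_le, hS.cover⟩ (F.lambdaSeq_subset_X n)

theorem omegaSet_subset_attractor {x : ℝ} (hx : x ∈ F.Xtilde) :
    omegaSet F.toFun x ⊆ F.attractor := by
  have key : ∀ n m, F.toFun^[m + (n + 1)] x ∈ F.lambdaSeq n := fun n => by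
    induction n with
    | zero =>
      intro m
      refine subset_closure ⟨_, hx m, ?_⟩
      rw [zero_add, Function.iterate_succ_apply']
    | succ n ih =>
      intro m
      refine subset_closure ⟨_, ⟨ih m, (hx _).2⟩, ?_⟩
      rw [← add_assoc m (n + 1), Function.iterate_succ_apply']
  intro y hy
  refine mem_iInter.2 fun n => ?_
  rw [← F.omegaSet_iterate (n + 1)] at hy
  obtain ⟨φ, -, h⟩ := mem_omegaSet_iff.1 hy
  have hcl : IsClosed (F.lambdaSeq n) := by cases n <;> exact isClosed_closure
  refine hcl.mem_of_tendsto h (Eventually.of_forall fun j => ?_)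
  rw [← Function.iterate_add_apply]
  exact key n _

/-- If `y` were in no `ω(d)`, only finitely many points of `orbitsD` would lie near `y`. A
sufficiently short nondegenerate interval around `y` cannot have two of them as ends. -/
theorem exists_mem_omegaSet_of_mem_attractor (hinj : ∀ i < F.N, InjOn F.toFun (F.piece i))
    (hD : F.D ⊆ F.Xtilde) {y : ℝ} (hy : y ∈ F.attractor) : ∃ d ∈ F.D, y ∈ omegaSet F.toFun d := by
  by_contra hcon
  push Not at hcon
  have h1 : ∀ᶠ δ : ℝ in 𝓝[>] 0, ∀ d ∈ F.D, ∀ᶠ n in atTop, δ ≤ |F.toFun^[n] d - y| :=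
    (eventually_all_finite F.finite_D).2 fun d hd =>
      F.eventually_le_abs_sub_of_notMem_omegaSet (hcon d hd)
  obtain ⟨δ, h2, hδ⟩ := (h1.and self_mem_nhdsWithin).exists
  rw [← eventually_all_finite F.finite_D, eventually_atTop] at h2
  obtain ⟨m, hm⟩ := h2
  -- Every point of `orbitsD` within `δ` of `y` has the form `f^n(d)` with `n < m`, so it belongs to
  -- this finite set.
  set R : Set ℝ := image2 (fun n d => F.toFun^[n] d) (Iio m) F.D with hR
  have hRfin : R.Finite := (Set.finite_Iio m).image2 _ F.finite_D
  obtain ⟨η, hη, hsep⟩ := hRfin.exists_pos_separated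
  have hsmall : ∀ᶠ n in atTop, F.lam ^ (n + 1) * (F.c F.N - F.c 0) < min δ η :=
    ((F.tendsto_lam_pow_mul _).comp (tendsto_add_atTop_nat 1)).eventually
      (gt_mem_nhds (lt_min hδ hη))
  obtain ⟨n, hn⟩ := hsmall.exists
  obtain ⟨S, hS⟩ := exists_isIntervalCover_lambdaSeq hinj hD n
  obtain ⟨p, hp, hyp⟩ := hS.cover y (mem_iInter.1 hy n)
  have hlen := (hS.length_le p hp).trans_lt hn
  have hmemR : ∀ q ∈ F.orbitsD, |q - y| < δ → q ∈ R := by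
    rintro _ ⟨d, hd, k, rfl⟩ hq
    refine ⟨k, ?_, d, hd, rfl⟩
    by_contra hk
    exact absurd (hm k (not_lt.1 hk) d hd) (not_le.2 hq)
  have hl := hmemR _ (hS.left p hp) (by
    rw [abs_lt]; constructor <;> linarith [hyp.1, hyp.2, min_le_left δ η])
  have hr := hmemR _ (hS.right p hp) (by
    rw [abs_lt]; constructor <;> linarith [hyp.1, hyp.2, min_le_left δ η])
  refine (hS.lt p hp).ne (hsep _ hl _ hr ?_)
  rw [abs_lt]
  constructor <;> linarith [hS.lt p hp, min_le_right δ η]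

/-! ### One-sided limits attracted by a periodic orbit -/

theorem sideLim_mem_D (F : PCIM) {k : ℕ} (h1 : 1 ≤ k) (hk : k < F.N) (b : Bool) :
    F.sideLim (F.c k) b ∈ F.D := by
  cases b
  · exact Or.inl ⟨k, h1, hk.le, rfl⟩
  · exact Or.inr ⟨k, hk, rfl⟩

/-- Take `o ∈ A` and an interior `c k` at minimal distance. The limit at `c k` on the side of `o` is
closer to `f o` than this distance, which no point of `A` can undercut, so the two orbits are never
separated. -/
theorem IsPeriodicOrbit.exists_omegaSet_sideLim_eq (hD : F.D ⊆ F.Xtilde) {A : Set ℝ}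
    (hA : F.IsPeriodicOrbit A) :
    ∃ k, 1 ≤ k ∧ k < F.N ∧ ∃ b, omegaSet F.toFun (F.sideLim (F.c k) b) = A := by
  obtain ⟨o₀, ho₀⟩ := hA.nonempty
  obtain ⟨⟨o, k⟩, ⟨ho, hk1, hkN⟩, hmin⟩ := Set.exists_min_image (A ×ˢ Ico 1 F.N)
    (fun p => |p.1 - F.c p.2|) (hA.finite.prod (Set.finite_Ico _ _))
    ⟨(o₀, 1), ho₀, le_rfl, F.two_le_N⟩
  simp only at ho hk1 hkN hmin
  have hoX := hA.1 ho
  have hne : o ≠ F.c k := fun e => F.Xtilde_disjoint_Δ hoX (e ▸ F.c_mem_Δ hk1 hkN)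
  have hckX := F.c_mem_X hkN.le
  have hbetween : ∀ k' ≤ F.N, ¬ (o < F.c k' ∧ F.c k' < F.c k) ∧
      ¬ (F.c k < F.c k' ∧ F.c k' < o) := fun k' hk' => by
    rcases Nat.eq_zero_or_pos k' with rfl | h0
    · exact ⟨fun h => h.1.not_ge (F.Xtilde_subset_X hoX).1, fun h => h.1.not_ge hckX.1⟩
    rcases hk'.lt_or_eq with h1 | rfl
    · have := hmin (o, k') ⟨ho, h0, h1⟩
      simp only at this
      constructor <;> rintro ⟨h2, h3⟩
      · rw [abs_of_neg (by linarith), abs_of_neg (by linarith)] at this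
        linarith
      · rw [abs_of_pos (by linarith), abs_of_pos (by linarith)] at this
        linarith
    · exact ⟨fun h => h.2.not_ge hckX.2, fun h => h.2.not_ge (F.Xtilde_subset_X hoX).2⟩
  obtain ⟨b, hb⟩ : ∃ b, |F.toFun o - F.sideLim (F.c k) b| ≤ F.lam * |o - F.c k| := by
    rcases lt_or_gt_of_ne hne with h | h
    · refine ⟨false, F.abs_sub_leftLim_le hckX (hoX 0) h fun c' hc' => ?_⟩
      obtain ⟨k', hk', rfl⟩ := F.exists_eq_c_of_mem_Δ hc'
      exact (hbetween k' hk').1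
    · refine ⟨true, F.abs_sub_rightLim_le hckX (hoX 0) h fun c' hc' => ?_⟩
      obtain ⟨k', hk', rfl⟩ := F.exists_eq_c_of_mem_Δ hc'
      exact (hbetween k' hk').2
  refine ⟨k, hk1, hkN, b, ?_⟩
  have hfo : F.toFun o ∈ A := hA.orbit_subset ho ⟨1, rfl⟩
  have hd := hD (F.sideLim_mem_D hk1 hkN b)
  rw [← hA.omegaSet_eq hfo]
  refine F.omegaSet_eq_of_notSep hd (hA.1 hfo) (F.notSep_iterate_of_abs_lt hd (hA.1 hfo)
    (δ := |o - F.c k|) (fun n k' h1 h2 => hmin (_, k') ⟨hA.orbit_subset hfo ⟨n, rfl⟩, h1, h2⟩) ?_)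
  rw [abs_sub_comm]
  exact hb.trans_lt (mul_lt_of_lt_one_left (abs_pos.2 (sub_ne_zero.2 hne)) F.lam_lt_one)

/-- Minimize only the distance from a point of `A` to a `c k` on its right. Since `f` preserves
order on pieces, the orbit of `d_k⁻` stays to the right of that of `f o`, and only points of `Δ` to
the right of `A` could separate them. -/
theorem IsPeriodicOrbit.exists_omegaSet_dMinus_eq (hD : F.D ⊆ F.Xtilde)
    (hmono : ∀ i < F.N, MonotoneOn F.toFun (F.piece i)) {A : Set ℝ} (hA : F.IsPeriodicOrbit A) :
    ∃ k, 1 ≤ k ∧ k ≤ F.N ∧ omegaSet F.toFun (F.dMinus k) = A := by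
  have hN := F.two_le_N
  -- If `c N` is not in `A`, every point of `A` is strictly to the left of some `c k`, so the
  -- minimum below exists.
  by_cases hcN : F.c F.N ∈ A
  · refine ⟨F.N, by omega, le_rfl, hA.omegaSet_eq ?_⟩
    rw [dMinus, F.leftLim_eq_of_notMem_Δ (a := F.c F.N) (hA.1 hcN 0) F.c_zero_lt_c_N]
    exact hA.orbit_subset hcN ⟨1, rfl⟩
  obtain ⟨o₀, ho₀⟩ := hA.nonempty
  obtain ⟨⟨o, k⟩, ⟨⟨ho, hk1, hkN⟩, hok⟩, hmin⟩ := Set.exists_min_image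
    {p : ℝ × ℕ | p ∈ A ×ˢ Icc 1 F.N ∧ p.1 < F.c p.2} (fun p => F.c p.2 - p.1)
    ((hA.finite.prod (Set.finite_Icc _ _)).subset fun p hp => hp.1)
    ⟨(o₀, F.N), ⟨ho₀, by omega, le_rfl⟩,
      lt_of_le_of_ne (F.Xtilde_subset_X (hA.1 ho₀)).2 fun e => hcN (e ▸ ho₀)⟩
  simp only at ho hk1 hkN hmin hok
  have hfar : ∀ a ∈ A, ∀ c' ∈ F.Δ, a < c' → F.c k - o ≤ c' - a := fun a ha c' hc' hac => by
    obtain ⟨k', hk', rfl⟩ := F.exists_eq_c_of_mem_Δ hc'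
    refine hmin (a, k') ⟨⟨ha, Nat.one_le_iff_ne_zero.2 ?_, hk'⟩, hac⟩
    rintro rfl
    exact hac.not_ge (F.Xtilde_subset_X (hA.1 ha)).1
  have hoX := hA.1 ho
  have hno : ∀ c' ∈ F.Δ, c' ∉ Ioo o (F.c k) := fun c' hc' h => by
    linarith [hfar o ho c' hc' h.1, h.2]
  have hd : F.dMinus k ∈ F.Xtilde := hD (Or.inl ⟨k, hk1, hkN, rfl⟩)
  have hdist := F.abs_sub_leftLim_le (u := o) (F.c_mem_X hkN) (hoX 0) hok hno
  rw [abs_sub_comm, abs_sub_comm o, abs_of_pos (sub_pos.2 hok)] at hdist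
  have hle : F.toFun o ≤ F.dMinus k := by
    obtain ⟨i, hi, h1, h2⟩ :=
      F.exists_c_le_and_le_c (F.Xtilde_subset_X hoX) (F.c_mem_X hkN) hok hno
    refine ge_of_tendsto (F.tendsto_dMinus hk1 hkN) ?_
    filter_upwards [Ioo_mem_nhdsLT hok] with y hy
    exact hmono i hi ⟨⟨h1, hok.le.trans h2⟩, (hoX 0).2⟩
      (F.Ioo_subset_piece hi ⟨h1.trans_lt hy.1, hy.2.trans_le h2⟩) hy.1.le
  have hfo : F.toFun o ∈ A := hA.orbit_subset ho ⟨1, rfl⟩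
  have hforb : ∀ n, F.toFun^[n] (F.toFun o) ∈ A := fun n => hA.orbit_subset hfo ⟨n, rfl⟩
  have hsep : ∀ n, F.toFun^[n] (F.toFun o) ≤ F.toFun^[n] (F.dMinus k) →
      F.toFun^[n] (F.dMinus k) - F.toFun^[n] (F.toFun o) < F.c k - o →
      F.NotSep (F.toFun^[n] (F.toFun o)) (F.toFun^[n] (F.dMinus k)) := fun n h1 h2 c' hc' =>
    ⟨fun h => by linarith [hfar _ (hforb n) c' hc' h], h1.trans_lt⟩
  have key : ∀ n, F.toFun^[n] (F.toFun o) ≤ F.toFun^[n] (F.dMinus k) ∧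
      F.toFun^[n] (F.dMinus k) - F.toFun^[n] (F.toFun o) < F.c k - o := fun n => by
    induction n with
    | zero =>
      refine ⟨hle, ((le_abs_self _).trans hdist).trans_lt ?_⟩
      exact mul_lt_of_lt_one_left (sub_pos.2 hok) F.lam_lt_one
    | succ n ih =>
      have hns := hsep n ih.1 ih.2
      obtain ⟨i, hi, h1, h2⟩ := F.exists_piece_of_notSep (hA.1 hfo n) (hd n) hns
      rw [Function.iterate_succ_apply', Function.iterate_succ_apply' F.toFun n (F.dMinus k)]
      refine ⟨hmono i hi h1 h2 ih.1, ((le_abs_self _).trans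
        (F.abs_sub_le_of_mem_piece hi h2 h1)).trans_lt (lt_of_le_of_lt ?_ ih.2)⟩
      rw [abs_of_nonneg (sub_nonneg.2 ih.1)]
      exact mul_le_of_le_one_left (sub_nonneg.2 ih.1) F.lam_lt_one.le
  refine ⟨k, hk1, hkN, ?_⟩
  rw [← hA.omegaSet_eq hfo]
  exact F.omegaSet_eq_of_notSep hd (hA.1 hfo) fun n => (hsep n (key n).1 (key n).2).symm

theorem exists_isRecurrentSide (hinj : ∀ i < F.N, InjOn F.toFun (F.piece i))
    (hD : F.D ⊆ F.Xtilde) {x : ℝ} (hx : x ∈ F.Xtilde)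
    (hper : ¬ F.IsPeriodicOrbit (omegaSet F.toFun x)) :
    ∃ c b, F.IsRecurrentSide c b ∧ omegaSet F.toFun x = omegaSet F.toFun (F.sideLim c b) := by
  obtain ⟨c, hc, b, hv, hr, he⟩ := (isPeriodicOrbit_or_exists_recurrent hinj hD hx).resolve_left hper
  exact ⟨c, b, ⟨hc, (hv.sideLim_spec (F.Xtilde_subset_X hx) hc).1, hr⟩, he⟩

/-- Thus the limit sets of points of `D` exhaust all limit sets, which gives finiteness and the
bound by `# D`. -/
theorem omegaSet_mem_image_D (hinj : ∀ i < F.N, InjOn F.toFun (F.piece i))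
    (hD : F.D ⊆ F.Xtilde) {x : ℝ} (hx : x ∈ F.Xtilde) :
    omegaSet F.toFun x ∈ omegaSet F.toFun '' F.D := by
  by_cases hper : F.IsPeriodicOrbit (omegaSet F.toFun x)
  · obtain ⟨k, h1, hk, b, he⟩ := hper.exists_omegaSet_sideLim_eq hD
    exact ⟨_, F.sideLim_mem_D h1 hk b, he⟩
  · obtain ⟨c, b, h, he⟩ := exists_isRecurrentSide hinj hD hx hper
    exact ⟨_, h.mem_D, he.symm⟩

theorem _root_.Set.Finite.exists_fin_injective_range_eq {α : Type*} {S : Set α} (hS : S.Finite) :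
    ∃ e : Fin S.ncard → α, Function.Injective e ∧ range e = S := by
  have := hS.to_subtype
  refine ⟨fun i => ((Finite.equivFin S).symm i : α),
    Subtype.val_injective.comp (Equiv.injective _), ?_⟩
  ext y
  constructor
  · rintro ⟨i, rfl⟩
    exact Subtype.coe_prop _
  · intro hy
    exact ⟨Finite.equivFin S ⟨y, hy⟩, congrArg Subtype.val (Equiv.symm_apply_apply _ _)⟩

end PCIM

/-! ### Assembly of the decomposition and counting of the limit sets. -/

open PCIM in
theorem mainTheorem1 (F : PCIM)
    (hinj : ∀ i < F.N, InjOn F.toFun (F.piece i))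
    (hD : F.D ⊆ F.Xtilde) :
    ∃ (N₁ N₂ : ℕ) (O : Fin N₁ → Set ℝ) (K : Fin N₂ → Set ℝ),
      -- the pieces are pairwise distinct
      Function.Injective (Sum.elim O K) ∧
      -- decomposition of the attractor
      (∀ i, F.IsPeriodicOrbit (O i)) ∧
      (∀ j, F.IsXtildeMinimal (K j) ∧ F.IsPseudoInvariant (K j) ∧ IsCantorSet (K j)) ∧
      F.attractor = (⋃ i, O i) ∪ (⋃ j, K j) ∧
      -- limit sets of the points of `X̃`
      (∀ x ∈ F.Xtilde, (∃ i, omegaSet F.toFun x = O i) ∨ (∃ j, omegaSet F.toFun x = K j)) ∧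
      -- each Cantor piece contains a boundary point both of whose one-sided limits generate it
      (∀ j, ∃ k, 1 ≤ k ∧ k < F.N ∧ F.c k ∈ K j ∧
        K j = closure (orbit F.toFun (F.dPlus k)) ∧
        K j = closure (orbit F.toFun (F.dMinus k))) ∧
      -- all the boundary points in a Cantor piece
      (∀ j, ∀ k, 1 ≤ k → k < F.N → F.c k ∈ K j →
        (K j = closure (orbit F.toFun (F.dPlus k)) ∨
          K j = closure (orbit F.toFun (F.dMinus k))) ∧
        (¬ IsGapBoundaryPoint F.X (K j) (F.c k) →
          closure (orbit F.toFun (F.dPlus k)) = closure (orbit F.toFun (F.dMinus k)))) ∧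
      -- counting
      1 ≤ N₁ + N₂ ∧ N₁ + N₂ ≤ F.D.ncard ∧ N₁ + 2 * N₂ ≤ 2 * (F.N - 1) ∧
      ((∀ i < F.N, MonotoneOn F.toFun (F.piece i)) → N₁ + N₂ ≤ F.N) := by
  have hSfin : (omegaSet F.toFun '' F.D).Finite := F.finite_D.image _
  set P : Set (Set ℝ) := {A ∈ omegaSet F.toFun '' F.D | F.IsPeriodicOrbit A} with hP
  set Q : Set (Set ℝ) := {A ∈ omegaSet F.toFun '' F.D | ¬ F.IsPeriodicOrbit A} with hQ
  have hPfin : P.Finite := hSfin.subset fun A hA => hA.1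
  have hQfin : Q.Finite := hSfin.subset fun A hA => hA.1
  have hPQ : P ∪ Q = omegaSet F.toFun '' F.D := by
    ext A
    by_cases h : F.IsPeriodicOrbit A <;> simp [hP, hQ, h]
  have hcard : P.ncard + Q.ncard = (omegaSet F.toFun '' F.D).ncard := by
    rw [← hPQ, ncard_union_eq (Set.disjoint_left.2 fun A h1 h2 => h2.2 h1.2) hPfin hQfin]
  obtain ⟨O, hOinj, hO⟩ := hPfin.exists_fin_injective_range_eq
  obtain ⟨K, hKinj, hK⟩ := hQfin.exists_fin_injective_range_eq
  have hOP : ∀ i, O i ∈ P := fun i => hO ▸ mem_range_self i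
  have hKQ : ∀ j, K j ∈ Q := fun j => hK ▸ mem_range_self j
  have hOK : Function.Injective (Sum.elim O K) :=
    hOinj.sumElim hKinj fun i j e => (hKQ j).2 (e ▸ (hOP i).2)
  have hrec : ∀ j, ∃ c b, F.IsRecurrentSide c b ∧ K j = omegaSet F.toFun (F.sideLim c b) := by
    intro j
    obtain ⟨⟨d, hd, he⟩, hper⟩ := hKQ j
    rw [← he] at hper ⊢
    exact exists_isRecurrentSide hinj hD (hD hd) hper
  have hlim : ∀ x ∈ F.Xtilde,
      (∃ i, omegaSet F.toFun x = O i) ∨ (∃ j, omegaSet F.toFun x = K j) := by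
    intro x hx
    have hmem := omegaSet_mem_image_D hinj hD hx
    rw [← hPQ, ← hO, ← hK] at hmem
    rcases hmem with ⟨i, hi⟩ | ⟨j, hj⟩
    · exact Or.inl ⟨i, hi.symm⟩
    · exact Or.inr ⟨j, hj.symm⟩
  -- A `c k` approached from both sides has both one-sided limits in the Cantor set, and by
  -- minimality each of them generates it.
  have hboth : ∀ j, ∃ k, 1 ≤ k ∧ k < F.N ∧ F.c k ∈ K j ∧
      ∀ b, K j = closure (orbit F.toFun (F.sideLim (F.c k) b)) ∧
        K j = omegaSet F.toFun (F.sideLim (F.c k) b) := by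
    intro j
    obtain ⟨c, b, h, he⟩ := hrec j
    obtain ⟨c', hc', h1, h2⟩ := h.exists_visits_both hD
    obtain ⟨k, hk1, hkN, rfl⟩ := F.exists_interior_index (h.mem_X hD) hc' h1 h2
    have hv : ∀ b', F.Visits (F.sideLim c b) (side (F.c k) b') := fun b' => by
      cases b'
      exacts [h2, h1]
    rw [he]
    refine ⟨k, hk1, hkN, h1.mem_omegaSet, fun b' => ?_⟩
    obtain ⟨h3, h4⟩ := h.sideLim_spec_of_visits hD hc' (hv b')
    exact ⟨(h.closure_orbit_eq hinj hD h3 h4).symm, h.omegaSet_eq hinj hD h3 h4⟩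
  refine ⟨P.ncard, Q.ncard, O, K, hOK, fun i => (hOP i).2, fun j => ?_, ?_, hlim, fun j => ?_,
    fun j k hk1 hkN hkj => ?_, ?_, ?_, ?_, fun hmono => ?_⟩
  · obtain ⟨c, b, h, he⟩ := hrec j
    rw [he]
    exact ⟨h.isXtildeMinimal hinj hD, h.isPseudoInvariant hD, h.isCantorSet hD⟩
  · refine Subset.antisymm (fun y hy => ?_) ?_
    · obtain ⟨d, hd, hyd⟩ := exists_mem_omegaSet_of_mem_attractor hinj hD hy
      rcases hlim d (hD hd) with ⟨i, hi⟩ | ⟨j, hj⟩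
      · exact Or.inl (mem_iUnion.2 ⟨i, hi ▸ hyd⟩)
      · exact Or.inr (mem_iUnion.2 ⟨j, hj ▸ hyd⟩)
    · have key : ∀ A ∈ omegaSet F.toFun '' F.D, A ⊆ F.attractor := by
        rintro _ ⟨d, hd, rfl⟩
        exact omegaSet_subset_attractor (hD hd)
      exact union_subset (iUnion_subset fun i => key _ (hOP i).1)
        (iUnion_subset fun j => key _ (hKQ j).1)
  · obtain ⟨k, hk1, hkN, hk, h⟩ := hboth j
    exact ⟨k, hk1, hkN, hk, (h true).1, (h false).1⟩
  · obtain ⟨c, b, h, he⟩ := hrec j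
    have hkΔ := F.c_mem_Δ hk1 hkN
    rw [he] at hkj ⊢
    have hgen : ∀ b', F.Visits (F.sideLim c b) (side (F.c k) b') → omegaSet F.toFun (F.sideLim c b) =
        closure (orbit F.toFun (F.sideLim (F.c k) b')) := fun b' hv => by
      obtain ⟨h3, h4⟩ := h.sideLim_spec_of_visits hD hkΔ hv
      exact (h.closure_orbit_eq hinj hD h3 h4).symm
    refine ⟨?_, fun hgap => ?_⟩
    · obtain ⟨b', hb'⟩ := F.exists_visits_side (hD h.mem_D) hkΔ hkj
      cases b'
      · exact Or.inr (hgen false hb')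
      · exact Or.inl (hgen true hb')
    · have hv := fun b' => (F.visits_side_or_isGapBoundaryPoint
        ⟨F.c_lt_c hk1 hkN.le, F.c_lt_c hkN le_rfl⟩ hkj b').resolve_right hgap
      exact (hgen true (hv true)).symm.trans (hgen false (hv false))
  · rw [hcard, Nat.one_le_iff_ne_zero, Ne, ncard_eq_zero hSfin, image_eq_empty,
      ← Ne, ← nonempty_iff_ne_empty]
    exact ⟨_, F.sideLim_mem_D le_rfl F.two_le_N true⟩
  · rw [hcard]
    exact ncard_image_le F.finite_D
  · have hper := fun i => (hOP i).2.exists_omegaSet_sideLim_eq hD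
    choose p hp1 hpN pb hp using hper
    choose q hq1 hqN _ hq using hboth
    set g : ℕ × Bool → Set ℝ := fun s => omegaSet F.toFun (F.sideLim (F.c s.1) s.2) with hg
    -- A periodic orbit is charged to one side of an interior partition point, a Cantor set to both
    -- sides of one. Injectivity holds because the limit set attached to a side recovers the piece.
    set e : Fin P.ncard ⊕ (Fin Q.ncard × Bool) → Ico 1 F.N × Bool :=
      Sum.elim (fun i => (⟨p i, hp1 i, hpN i⟩, pb i)) fun s => (⟨q s.1, hq1 s.1, hqN s.1⟩, s.2) with he
    have hge : ∀ s, omegaSet F.toFun (F.sideLim (F.c (e s).1) (e s).2) =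
        Sum.elim O K (Sum.map id Prod.fst s) := by
      rintro (i | ⟨j, b⟩)
      · exact hp i
      · exact ((hq j b).2).symm
    have hinj' : Function.Injective e := fun s t hst => by
      have h1 := hOK ((hge s).symm.trans ((congrArg (fun r : Ico 1 F.N × Bool =>
        omegaSet F.toFun (F.sideLim (F.c r.1) r.2)) hst).trans (hge t)))
      rcases s with i | ⟨j, b⟩ <;> rcases t with i' | ⟨j', b'⟩ <;>
        simp_all
    have := Fintype.card_le_of_injective e hinj'
    simp at this
    omega
  · have hper := fun i => (hOP i).2.exists_omegaSet_dMinus_eq hD hmono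
    choose p hp1 hpN hp using hper
    choose q hq1 hqN _ hq using hboth
    -- In the increasing case every piece is the limit set of some `d_k⁻` with `1 ≤ k ≤ N`, so left
    -- limits alone suffice.
    set e : Fin P.ncard ⊕ Fin Q.ncard → Icc 1 F.N :=
      Sum.elim (fun i => ⟨p i, hp1 i, hpN i⟩) fun j => ⟨q j, hq1 j, (hqN j).le⟩ with he
    have hge : ∀ s, omegaSet F.toFun (F.dMinus (e s)) = Sum.elim O K s := by
      rintro (i | j)
      · exact hp i
      · exact ((hq j false).2).symm
    have hinj' : Function.Injective e := fun s t hst =>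
      hOK ((hge s).symm.trans ((congrArg (fun r : Icc 1 F.N =>
        omegaSet F.toFun (F.dMinus r)) hst).trans (hge t)))
    have := Fintype.card_le_of_injective e hinj'
    simpa using this
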